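/- Let $n\ge 2$ and let $\mu_1,\dots,\mu_n>0$ be real numbers; all spaces and algebras below are taken over the field $\mathbb K=\mathbb R$ or $\mathbb K=\mathbb C$. Let $\mathfrak{su}(1,1)$ be the Lie algebra with basis $J_+,J_-,A_0$ and brackets $[J_-,J_+]=2A_0$, $[A_0,J_\pm]=\pm J_\pm$, and let $C=A_0^2-A_0-J_+J_-\in\mathcal U(\mathfrak{su}(1,1))$ be its Casimir element. For $A\subset[n]=\{1,\dots,n\}$ let $C_A\in\mathcal U(\mathfrak{su}(1,1))^{\otimes n}$ be the image of $C$ under the algebra morphism $\mathcal U(\mathfrak{su}(1,1))\to\mathcal U(\mathfrak{su}(1,1))^{\otimes n}$ that sends $x\in\mathfrak{su}(1,1)$ to $\sum_{i\in A}1\otimes\cdots\otimes x\otimes\cdots\otimes 1$ ($x$ at the $i$-th place). The Racah algebra $R(n)$ is the subalgebra of $\mathcal U(\mathfrak{su}(1,1))^{\otimes n}$ generated by all $C_A$, $A\subset[n]$. Let $r_i$ be the reflection $y_i\mapsto -y_i$ and $T_i=\partial_{y_i}+\frac{\mu_i}{y_i}(1-r_i)$ the Dunkl operators on $\mathbb K[y_1,\dots,y_n]$.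 Let $\mathcal U(\mathfrak{su}(1,1))^{\otimes n}$, and hence $R(n)$, act on $\mathbb K[y_1,\dots,y_n]$ by letting the generators of the $i$-th tensor factor act as $$J_+\mapsto \tfrac12 y_i^2,\qquad J_-\mapsto\tfrac12T_i^2,\qquad A_0\mapsto \tfrac12\left(y_i\partial_{y_i}+\tfrac12+\mu_i\right).$$ Let $\Delta=\sum_{i=1}^nT_i^2$. For an integer $a\ge 0$ and $\epsilon\in\{0,1\}^n$ let $\mathcal H_a^{\epsilon}$ be the space of homogeneous polynomials $p$ of degree $a$ with $\Delta p=0$ and $r_ip=(-1)^{\epsilon_i}p$ for all $i\in[n]$. If $a=\sum_{i=1}^n\epsilon_i+2N$ for some integer $N\ge 0$, then $\mathcal H_a^{\epsilon}$ is an irreducible representation of $R(n)$: it is nonzero, it is stable under $R(n)$, and its only $R(n)$-stable subspaces are $0$ and $\mathcal H_a^{\epsilon}$ itself. If $a$ is not of this form, then $\mathcal H_a^{\epsilon}=0$. -/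

import Mathlib

open MvPolynomial TensorProduct

attribute [local instance 100] LieRing.ofAssociativeRing

noncomputable section

namespace RacahDunkl

/-! ### The Lie algebra `su(1,1)` and its Casimir element -/

/-- The Lie algebra `su(1,1)` over `K`: the three-dimensional space of coordinate vectors
`(p, m, a)`, standing for `p J₊ + m J₋ + a A₀`, with the bracket determined by
`[J₋, J₊] = 2 A₀`, `[A₀, J₊] = J₊`, `[A₀, J₋] = - J₋`. -/
def Su11 (K : Type*) : Type _ := Fin 3 → K

section Su11

theorem su11_ext {K : Type*} {x y : Su11 K} (h0 : x 0 = y 0) (h1 : x 1 = y 1) (h2 : x 2 = y 2) : x = y := by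
  funext i
  fin_cases i
  · exact h0
  · exact h1
  · exact h2

variable (K : Type*) [Field K]

instance : AddCommGroup (Su11 K) := inferInstanceAs (AddCommGroup (Fin 3 → K))

instance : Module K (Su11 K) := inferInstanceAs (Module K (Fin 3 → K))

/-- The generator `J₊`. -/
def jPlus : Su11 K := ![1, 0, 0]

/-- The generator `J₋`. -/
def jMinus : Su11 K := ![0, 1, 0]

/-- The generator `A₀`. -/
def aZero : Su11 K := ![0, 0, 1]

variable {K}

theorem su11_add_apply (x y : Su11 K) (i : Fin 3) : (x + y) i = x i + y i := rfl

theorem su11_smul_apply (c : K) (x : Su11 K) (i : Fin 3) : (c • x) i = c * x i := rfl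

theorem su11_zero_apply (i : Fin 3) : (0 : Su11 K) i = 0 := rfl

instance : Bracket (Su11 K) (Su11 K) :=
  ⟨fun x y => ![x 2 * y 0 - x 0 * y 2, x 1 * y 2 - x 2 * y 1, 2 * (x 1 * y 0 - x 0 * y 1)]⟩

theorem su11_lie_zero (x y : Su11 K) : ⁅x, y⁆ 0 = x 2 * y 0 - x 0 * y 2 := rfl

theorem su11_lie_one (x y : Su11 K) : ⁅x, y⁆ 1 = x 1 * y 2 - x 2 * y 1 := rfl

theorem su11_lie_two (x y : Su11 K) : ⁅x, y⁆ 2 = 2 * (x 1 * y 0 - x 0 * y 1) := rfl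

instance : LieRing (Su11 K) where
  add_lie x y z := by
    apply su11_ext <;> simp only [su11_lie_zero, su11_lie_one, su11_lie_two, su11_add_apply] <;> ring
  lie_add x y z := by
    apply su11_ext <;> simp only [su11_lie_zero, su11_lie_one, su11_lie_two, su11_add_apply] <;> ring
  lie_self x := by
    apply su11_ext <;>
      simp only [su11_lie_zero, su11_lie_one, su11_lie_two, su11_zero_apply] <;> ring
  leibniz_lie x y z := by
    apply su11_ext <;> simp only [su11_lie_zero, su11_lie_one, su11_lie_two, su11_add_apply] <;> ring

instance : LieAlgebra K (Su11 K) where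
  lie_smul c x y := by
    apply su11_ext <;>
      simp only [su11_lie_zero, su11_lie_one, su11_lie_two, su11_smul_apply] <;> ring

theorem lie_jMinus_jPlus : ⁅jMinus K, jPlus K⁆ = (2 : K) • aZero K := by
  apply su11_ext <;> simp only [su11_lie_zero, su11_lie_one, su11_lie_two, su11_smul_apply] <;>
    simp [jMinus, jPlus, aZero]

theorem lie_aZero_jPlus : ⁅aZero K, jPlus K⁆ = jPlus K := by
  apply su11_ext <;> simp only [su11_lie_zero, su11_lie_one, su11_lie_two] <;>
    simp [jPlus, aZero]

theorem lie_aZero_jMinus : ⁅aZero K, jMinus K⁆ = -jMinus K := by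
  rw [← neg_one_smul K (jMinus K)]
  apply su11_ext <;> simp only [su11_lie_zero, su11_lie_one, su11_lie_two, su11_smul_apply] <;>
    simp [jMinus, aZero]

/-- Three elements `P`, `M`, `A` of an associative algebra that satisfy the commutation relations
of `J₊`, `J₋`, `A₀` give a morphism from the Lie algebra `su(1,1)`. -/
def su11LieHom {B : Type*} [Ring B] [Algebra K B] (P M A : B)
    (h₁ : M * P - P * M = (2 : K) • A) (h₂ : A * P - P * A = P) (h₃ : A * M - M * A = -M) :
    Su11 K →ₗ⁅K⁆ B where
  toFun x := x 0 • P + x 1 • M + x 2 • A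
  map_add' x y := by
    simp only [su11_add_apply, add_smul]
    abel
  map_smul' c x := by
    simp only [su11_smul_apply, mul_smul, smul_add, RingHom.id_apply]
  map_lie' := by
    intro x y
    have h : ⁅x 0 • P + x 1 • M + x 2 • A, y 0 • P + y 1 • M + y 2 • A⁆
        = (x 1 * y 0 - x 0 * y 1) • (M * P - P * M) + (x 2 * y 0 - x 0 * y 2) • (A * P - P * A)
          + (x 2 * y 1 - x 1 * y 2) • (A * M - M * A) := by
      simp only [LieRing.of_associative_ring_bracket, add_mul, mul_add, smul_mul_smul_comm, sub_smul,
        smul_sub]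
      simp only [mul_comm (y 0), mul_comm (y 1), mul_comm (y 2)]
      abel
    change _ = ⁅x 0 • P + x 1 • M + x 2 • A, y 0 • P + y 1 • M + y 2 • A⁆
    rw [h, h₁, h₂, h₃]
    simp only [su11_lie_zero, su11_lie_one, su11_lie_two, smul_smul, smul_neg, sub_smul, mul_sub,
      sub_mul]
    simp only [mul_comm (2 : K)]
    abel

end Su11

/-- The universal enveloping algebra `U(su(1,1))`. -/
abbrev USu11 (K : Type*) [Field K] : Type _ := UniversalEnvelopingAlgebra K (Su11 K)

/-- The Casimir element `C = A₀² - A₀ - J₊ J₋` of `U(su(1,1))`. -/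
def casimir (K : Type*) [Field K] : USu11 K :=
  UniversalEnvelopingAlgebra.ι K (aZero K) ^ 2 - UniversalEnvelopingAlgebra.ι K (aZero K)
    - UniversalEnvelopingAlgebra.ι K (jPlus K) * UniversalEnvelopingAlgebra.ι K (jMinus K)

/-! ### The Racah algebra `R(n)` -/

section Racah

variable (K : Type*) [Field K] (n : ℕ)

/-- The `n`-fold tensor power of `U(su(1,1))`. -/
abbrev TensorU : Type _ := ⨂[K] _ : Fin n, USu11 K

variable {K n}

/-- The map `u ↦ 1 ⊗ ⋯ ⊗ u ⊗ ⋯ ⊗ 1` with `u` at the `i`-th place. -/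
def slot (i : Fin n) : USu11 K →ₐ[K] TensorU K n :=
  PiTensorProduct.singleAlgHom (R := K) (A := fun _ : Fin n => USu11 K) i

theorem commute_slot {i j : Fin n} (h : i ≠ j) (u v : USu11 K) :
    Commute (slot i u) (slot j v) :=
  Commute.tprod (R := K) (A := fun _ : Fin n => USu11 K)
    (a₁ := Pi.mulSingle i u) (a₂ := Pi.mulSingle j v)
    (Pi.mulSingle_commute (f := fun _ : Fin n => USu11 K) h u v)

/-- The diagonal embedding `x ↦ ∑_{i ∈ A} 1 ⊗ ⋯ ⊗ x ⊗ ⋯ ⊗ 1` of `su(1,1)` at the places in `A`. -/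
def diagLie (A : Finset (Fin n)) : Su11 K →ₗ⁅K⁆ TensorU K n where
  toLinearMap := ∑ i ∈ A, (slot i).toLinearMap ∘ₗ
    (UniversalEnvelopingAlgebra.ι K : Su11 K →ₗ⁅K⁆ USu11 K).toLinearMap
  map_lie' := by
    intro x y
    have hs : ∀ z : Su11 K, (∑ i ∈ A, (slot i).toLinearMap ∘ₗ
        (UniversalEnvelopingAlgebra.ι K : Su11 K →ₗ⁅K⁆ USu11 K).toLinearMap) z
        = ∑ i ∈ A, slot i (UniversalEnvelopingAlgebra.ι K z) := by
      intro z
      rw [LinearMap.sum_apply]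
      rfl
    change (∑ i ∈ A, (slot i).toLinearMap ∘ₗ
        (UniversalEnvelopingAlgebra.ι K : Su11 K →ₗ⁅K⁆ USu11 K).toLinearMap) ⁅x, y⁆
      = ⁅(∑ i ∈ A, (slot i).toLinearMap ∘ₗ
        (UniversalEnvelopingAlgebra.ι K : Su11 K →ₗ⁅K⁆ USu11 K).toLinearMap) x,
        (∑ i ∈ A, (slot i).toLinearMap ∘ₗ
        (UniversalEnvelopingAlgebra.ι K : Su11 K →ₗ⁅K⁆ USu11 K).toLinearMap) y⁆
    rw [hs, hs, hs, LieRing.of_associative_ring_bracket, Finset.sum_mul_sum, Finset.sum_mul_sum]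
    conv_rhs => rw [Finset.sum_comm (s := A) (t := A), ← Finset.sum_sub_distrib]
    refine Finset.sum_congr rfl fun i hi => ?_
    rw [← Finset.sum_sub_distrib, Finset.sum_eq_single_of_mem i hi]
    · rw [LieHom.map_lie, LieRing.of_associative_ring_bracket, map_sub, map_mul, map_mul]
    · intro j _ hj
      rw [sub_eq_zero]
      exact commute_slot hj _ _

/-- The `|A|`-fold iterated comultiplication of `U(su(1,1))`, with its `|A|` tensor factors put
at the places in `A` and the unit at all other places. -/
def diag (A : Finset (Fin n)) : USu11 K →ₐ[K] TensorU K n :=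
  UniversalEnvelopingAlgebra.lift K (diagLie A)

/-- The Casimir operator `C_A`. -/
def casimirAt (A : Finset (Fin n)) : TensorU K n := diag A (casimir K)

variable (K n)

/-- The Racah algebra `R(n)`: the subalgebra of the `n`-fold tensor power of `U(su(1,1))` generated
by all `C_A` with `A` a subset of the index set. -/
def racahAlgebra : Subalgebra K (TensorU K n) :=
  Algebra.adjoin K (Set.range fun A : Finset (Fin n) => casimirAt A)

end Racah

/-! ### Dunkl operators on polynomials -/

section Dunkl

variable {K : Type*} [Field K] {n : ℕ}

/-- Multiplication by the variable `y_i`. -/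
def mulVar (i : Fin n) : Module.End K (MvPolynomial (Fin n) K) := LinearMap.mulLeft K (X i)

/-- The reflection `r_i`, which replaces `y_i` by `-y_i`. -/
def reflection (i : Fin n) : Module.End K (MvPolynomial (Fin n) K) :=
  (aeval fun j : Fin n => if j = i then -X j else X j :
    MvPolynomial (Fin n) K →ₐ[K] MvPolynomial (Fin n) K).toLinearMap

/-- The Euler operator `y_i ∂_{y_i}`. -/
def euler (i : Fin n) : Module.End K (MvPolynomial (Fin n) K) :=
  mulVar i ∘ₗ (pderiv i).toLinearMap

/-- Division by the variable `y_i` (monomials that are not divisible by `y_i` are sent to zero). -/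
def divVar (i : Fin n) : Module.End K (MvPolynomial (Fin n) K) where
  toFun p := p.divMonomial (Finsupp.single i 1)
  map_add' p q := add_divMonomial p q _
  map_smul' c p := by
    ext m
    simp [coeff_divMonomial]

/-- The Dunkl operator `T_i = ∂_{y_i} + (μ_i / y_i) (1 - r_i)`. -/
def dunkl (μ : Fin n → K) (i : Fin n) : Module.End K (MvPolynomial (Fin n) K) :=
  (pderiv i).toLinearMap + μ i • (divVar i ∘ₗ (1 - reflection i))

theorem coeff_reflection (i : Fin n) (p : MvPolynomial (Fin n) K) (m : Fin n →₀ ℕ) :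
    coeff m (reflection i p) = (-1) ^ m i * coeff m p := by
  induction p using MvPolynomial.induction_on' with
  | monomial s c =>
    have h : reflection i (monomial s c) = (-1 : K) ^ s i • monomial s c := by
      have h1 : ∀ j : Fin n, (if j = i then -X j else X j : MvPolynomial (Fin n) K) ^ s j
          = (if j = i then C ((-1 : K) ^ s i) else 1) * X j ^ s j := by
        intro j
        split_ifs with hj
        · subst hj
          rw [neg_pow, map_pow, map_neg, map_one]
        · rw [one_mul]
      change aeval (fun j : Fin n => if j = i then -X j else X j) (monomial s c) = _
      rw [aeval_monomial, Finsupp.prod_fintype _ _ (by simp)]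
      simp only [h1]
      rw [Finset.prod_mul_distrib, Finset.prod_ite_eq' Finset.univ i, if_pos (Finset.mem_univ i),
        smul_eq_C_mul, monomial_eq, Finsupp.prod_fintype _ _ (by simp), algebraMap_eq]
      ring
    rw [h, coeff_smul, smul_eq_mul, coeff_monomial]
    split_ifs with hs
    · rw [hs]
    · simp
  | add p q hp hq => rw [map_add, coeff_add, coeff_add, hp, hq, mul_add]

/-- The division in the definition of the Dunkl operator is exact. -/
theorem X_mul_divVar (i : Fin n) (p : MvPolynomial (Fin n) K) :
    X i * divVar i (p - reflection i p) = p - reflection i p := by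
  ext m
  rw [coeff_X_mul']
  split_ifs with h
  · change coeff _ (divMonomial _ _) = _
    rw [coeff_divMonomial, add_tsub_cancel_of_le]
    rw [Finsupp.single_le_iff]
    exact Nat.one_le_iff_ne_zero.2 (Finsupp.mem_support_iff.1 h)
  · rw [coeff_sub, coeff_reflection, Finsupp.notMem_support_iff.1 h]
    ring

theorem coeff_dunkl (μ : Fin n → K) (i : Fin n) (p : MvPolynomial (Fin n) K) (m : Fin n →₀ ℕ) :
    coeff m (dunkl μ i p)
      = ((m i + 1 : ℕ) + μ i * (1 - (-1) ^ (m i + 1))) * coeff (m + Finsupp.single i 1) p := by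
  have h : dunkl μ i p = pderiv i p
      + μ i • divMonomial (p - reflection i p) (Finsupp.single i 1) := rfl
  rw [h, coeff_add, coeff_smul, coeff_divMonomial, coeff_sub, coeff_reflection, coeff_pderiv,
    add_comm (Finsupp.single i 1) m]
  simp
  ring

theorem coeff_mulVar (i : Fin n) (p : MvPolynomial (Fin n) K) (m : Fin n →₀ ℕ) :
    coeff m (mulVar i p) = if m i = 0 then 0 else coeff (m - Finsupp.single i 1) p := by
  change coeff m (X i * p) = _
  rw [coeff_X_mul']
  by_cases h : m i = 0 <;> simp [h]

theorem coeff_euler (i : Fin n) (p : MvPolynomial (Fin n) K) (m : Fin n →₀ ℕ) :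
    coeff m (euler i p) = m i * coeff m p := by
  change coeff m (mulVar i (pderiv i p)) = _
  rw [coeff_mulVar]
  split_ifs with h
  · simp [h]
  · rw [coeff_pderiv, tsub_add_cancel_of_le
      (Finsupp.single_le_iff.2 (Nat.one_le_iff_ne_zero.2 h))]
    have h' : 1 ≤ m i := Nat.one_le_iff_ne_zero.2 h
    simp [Nat.cast_sub h', mul_comm]

theorem mulVar_commute (i j : Fin n) :
    Commute (mulVar i : Module.End K (MvPolynomial (Fin n) K)) (mulVar j) := by
  refine LinearMap.ext fun p => ?_
  change X i * (X j * p) = X j * (X i * p)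
  ring

theorem dunkl_commute (μ : Fin n → K) (i j : Fin n) : Commute (dunkl μ i) (dunkl μ j) := by
  by_cases hij : i = j
  · rw [hij]
  refine LinearMap.ext fun p => MvPolynomial.ext _ _ fun m => ?_
  simp only [Module.End.mul_apply, coeff_dunkl, Finsupp.add_apply, Finsupp.single_apply, hij,
    Ne.symm hij, if_false, add_zero]
  rw [add_right_comm m]
  ring

theorem dunkl_mulVar_commute (μ : Fin n → K) {i j : Fin n} (hij : i ≠ j) :
    Commute (dunkl μ i) (mulVar j) := by
  refine LinearMap.ext fun p => MvPolynomial.ext _ _ fun m => ?_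
  simp only [Module.End.mul_apply, coeff_dunkl, coeff_mulVar, Finsupp.add_apply,
    Finsupp.single_apply, Finsupp.tsub_apply, hij, Ne.symm hij, if_false, add_zero, tsub_zero]
  split_ifs with h
  · ring
  · rw [tsub_add_eq_add_tsub (Finsupp.single_le_iff.2 (Nat.one_le_iff_ne_zero.2 h))]

theorem dunkl_mul_mulVar (μ : Fin n → K) (i : Fin n) :
    dunkl μ i * mulVar i = mulVar i * dunkl μ i + 1 + (2 * μ i) • reflection i := by
  refine LinearMap.ext fun p => MvPolynomial.ext _ _ fun m => ?_
  simp only [Module.End.mul_apply, LinearMap.add_apply, LinearMap.smul_apply, Module.End.one_apply,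
    coeff_add, coeff_smul, coeff_dunkl, coeff_mulVar, coeff_reflection, Finsupp.add_apply,
    Finsupp.single_apply, Finsupp.tsub_apply, if_true, add_tsub_cancel_right, smul_eq_mul]
  rw [if_neg (Nat.succ_ne_zero _)]
  rcases Nat.eq_zero_or_pos (m i) with h | h
  · simp [h]
    ring
  · rw [if_neg h.ne', tsub_add_cancel_of_le (α := Fin n →₀ ℕ) (Finsupp.single_le_iff.2 h),
      Nat.sub_add_cancel h]
    push_cast
    ring

theorem euler_eq (μ : Fin n → K) (i : Fin n) :
    euler i + μ i • (1 - reflection i) = mulVar i * dunkl μ i := by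
  refine LinearMap.ext fun p => MvPolynomial.ext _ _ fun m => ?_
  simp only [Module.End.mul_apply, LinearMap.add_apply, LinearMap.smul_apply, LinearMap.sub_apply,
    Module.End.one_apply, coeff_add, coeff_sub, coeff_smul, coeff_dunkl, coeff_mulVar,
    coeff_reflection, coeff_euler, Finsupp.tsub_apply, Finsupp.single_apply, if_true, smul_eq_mul]
  rcases Nat.eq_zero_or_pos (m i) with h | h
  · simp [h]
  · rw [if_neg h.ne', tsub_add_cancel_of_le (α := Fin n →₀ ℕ) (Finsupp.single_le_iff.2 h),
      Nat.sub_add_cancel h]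
    ring

theorem reflection_mul_mulVar (i : Fin n) :
    (reflection i : Module.End K (MvPolynomial (Fin n) K)) * mulVar i
      = -(mulVar i * reflection i) := by
  refine LinearMap.ext fun p => MvPolynomial.ext _ _ fun m => ?_
  simp only [Module.End.mul_apply, LinearMap.neg_apply, coeff_neg, coeff_mulVar,
    coeff_reflection, Finsupp.tsub_apply, Finsupp.single_apply, if_true]
  rcases Nat.eq_zero_or_pos (m i) with h | h
  · simp [h]
  · rw [if_neg h.ne', if_neg h.ne']
    obtain ⟨k, hk⟩ := Nat.exists_eq_succ_of_ne_zero h.ne'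
    rw [hk, Nat.succ_sub_one, pow_succ]
    ring

theorem reflection_mul_dunkl (μ : Fin n → K) (i : Fin n) :
    reflection i * dunkl μ i = -(dunkl μ i * reflection i) := by
  refine LinearMap.ext fun p => MvPolynomial.ext _ _ fun m => ?_
  simp only [Module.End.mul_apply, LinearMap.neg_apply, coeff_neg, coeff_dunkl,
    coeff_reflection, Finsupp.add_apply, Finsupp.single_apply, if_true, pow_succ]
  ring

/-- The operator `J₊ = y_i² / 2`. -/
def opJPlus (i : Fin n) : Module.End K (MvPolynomial (Fin n) K) := (2 : K)⁻¹ • mulVar i ^ 2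

/-- The operator `J₋ = T_i² / 2`. -/
def opJMinus (μ : Fin n → K) (i : Fin n) : Module.End K (MvPolynomial (Fin n) K) :=
  (2 : K)⁻¹ • dunkl μ i ^ 2

/-- The operator `A₀ = (y_i ∂_{y_i} + γ_i) / 2` with `γ_i = 1/2 + μ_i`. -/
def opAZero (μ : Fin n → K) (i : Fin n) : Module.End K (MvPolynomial (Fin n) K) :=
  (2 : K)⁻¹ • (euler i + ((2 : K)⁻¹ + μ i) • 1)

theorem opAZero_eq (μ : Fin n → K) (i : Fin n) :
    opAZero μ i = (2 : K)⁻¹ • (mulVar i * dunkl μ i + (2 : K)⁻¹ • 1 + μ i • reflection i) := by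
  rw [opAZero, ← euler_eq μ i, add_smul, smul_sub]
  abel_nf

theorem dunkl_mul_mulVar_sq (μ : Fin n → K) (i : Fin n) :
    dunkl μ i * mulVar i ^ 2 = mulVar i ^ 2 * dunkl μ i + (2 : K) • mulVar i := by
  rw [pow_two, ← mul_assoc, dunkl_mul_mulVar, add_mul, add_mul, mul_assoc, dunkl_mul_mulVar,
    smul_mul_assoc, reflection_mul_mulVar, mul_add, mul_add, mul_smul_comm, smul_neg, two_smul,
    mul_one, one_mul, mul_assoc]
  abel

theorem dunkl_sq_mul_mulVar (μ : Fin n → K) (i : Fin n) :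
    dunkl μ i ^ 2 * mulVar i = mulVar i * dunkl μ i ^ 2 + (2 : K) • dunkl μ i := by
  rw [pow_two, mul_assoc, dunkl_mul_mulVar, mul_add, mul_add, ← mul_assoc, dunkl_mul_mulVar,
    add_mul, add_mul, smul_mul_assoc, reflection_mul_dunkl, mul_smul_comm, smul_neg, two_smul,
    mul_one, one_mul, mul_assoc]
  abel

theorem op_relation₁ [CharZero K] (μ : Fin n → K) (i : Fin n) :
    opJMinus μ i * opJPlus i - opJPlus i * opJMinus μ i = (2 : K) • opAZero μ i := by
  have h : dunkl μ i ^ 2 * mulVar i ^ 2 = mulVar i ^ 2 * dunkl μ i ^ 2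
      + (4 : K) • (mulVar i * dunkl μ i + (2 : K)⁻¹ • 1 + μ i • reflection i) := by
    calc dunkl μ i ^ 2 * mulVar i ^ 2 = dunkl μ i * (dunkl μ i * mulVar i ^ 2) := by
          rw [pow_two (dunkl μ i), mul_assoc]
      _ = (dunkl μ i * mulVar i ^ 2) * dunkl μ i + (2 : K) • (dunkl μ i * mulVar i) := by
          rw [dunkl_mul_mulVar_sq, mul_add, mul_smul_comm, ← mul_assoc, dunkl_mul_mulVar_sq]
      _ = _ := by
          rw [dunkl_mul_mulVar_sq, dunkl_mul_mulVar, add_mul, mul_assoc, ← pow_two, smul_mul_assoc]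
          module
  rw [opAZero_eq, opJMinus, opJPlus, smul_mul_smul_comm, smul_mul_smul_comm, h]
  module

theorem op_relation₂ [CharZero K] (μ : Fin n → K) (i : Fin n) :
    opAZero μ i * opJPlus i - opJPlus i * opAZero μ i = opJPlus i := by
  have h1 : mulVar i * dunkl μ i * mulVar i ^ 2
      = mulVar i ^ 2 * (mulVar i * dunkl μ i) + (2 : K) • mulVar i ^ 2 := by
    rw [mul_assoc, dunkl_mul_mulVar_sq, mul_add, mul_smul_comm, ← mul_assoc, ← mul_assoc,
      ← pow_two, ← pow_succ, ← pow_succ']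
  have h2 : reflection i * mulVar i ^ 2
      = (mulVar i ^ 2 * reflection i : Module.End K (MvPolynomial (Fin n) K)) := by
    have h : ∀ q : MvPolynomial (Fin n) K,
        reflection i (mulVar i q) = -mulVar i (reflection i q) :=
      fun q => LinearMap.congr_fun (reflection_mul_mulVar i) q
    refine LinearMap.ext fun p => ?_
    simp only [pow_two, Module.End.mul_apply, h, map_neg, neg_neg]
  rw [opAZero_eq, opJPlus, smul_mul_smul_comm, smul_mul_smul_comm, add_mul, add_mul, mul_add,
    mul_add, h1, smul_mul_assoc, smul_mul_assoc, h2, mul_smul_comm, mul_smul_comm, mul_one, one_mul]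
  module

theorem op_relation₃ [CharZero K] (μ : Fin n → K) (i : Fin n) :
    opAZero μ i * opJMinus μ i - opJMinus μ i * opAZero μ i = -opJMinus μ i := by
  have h1 : dunkl μ i ^ 2 * (mulVar i * dunkl μ i)
      = mulVar i * dunkl μ i * dunkl μ i ^ 2 + (2 : K) • dunkl μ i ^ 2 := by
    rw [← mul_assoc, dunkl_sq_mul_mulVar, add_mul, smul_mul_assoc, mul_assoc, mul_assoc,
      ← pow_two, ← pow_succ, ← pow_succ']
  have h2 : reflection i * dunkl μ i ^ 2 = dunkl μ i ^ 2 * reflection i := by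
    have h : ∀ q : MvPolynomial (Fin n) K,
        reflection i (dunkl μ i q) = -dunkl μ i (reflection i q) :=
      fun q => LinearMap.congr_fun (reflection_mul_dunkl μ i) q
    refine LinearMap.ext fun p => ?_
    simp only [pow_two, Module.End.mul_apply, h, map_neg, neg_neg]
  rw [opAZero_eq, opJMinus, smul_mul_smul_comm, smul_mul_smul_comm, add_mul, add_mul, mul_add,
    mul_add, h1, smul_mul_assoc, smul_mul_assoc, h2, mul_smul_comm, mul_smul_comm, mul_one, one_mul]
  module

/-- The realization of `U(su(1,1))` by operators in the single variable `y_i`: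
`J₊ ↦ y_i² / 2`, `J₋ ↦ T_i² / 2`, `A₀ ↦ (y_i ∂_{y_i} + γ_i) / 2`. -/
def dunklRepAt [CharZero K] (μ : Fin n → K) (i : Fin n) :
    USu11 K →ₐ[K] Module.End K (MvPolynomial (Fin n) K) :=
  UniversalEnvelopingAlgebra.lift K
    (su11LieHom (opJPlus i) (opJMinus μ i) (opAZero μ i)
      (op_relation₁ μ i) (op_relation₂ μ i) (op_relation₃ μ i))

theorem lift_mem_of_forall {B : Type*} [Ring B] [Algebra K B] (f : Su11 K →ₗ⁅K⁆ B)
    (S : Subalgebra K B) (h : ∀ x, f x ∈ S) (u : USu11 K) :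
    UniversalEnvelopingAlgebra.lift K f u ∈ S := by
  let g : Su11 K →ₗ⁅K⁆ S :=
    { toFun := fun x => ⟨f x, h x⟩
      map_add' := fun x y => Subtype.ext (map_add f x y)
      map_smul' := fun c x => Subtype.ext (map_smul f c x)
      map_lie' := fun {x y} => Subtype.ext (LieHom.map_lie f x y) }
  have hg : S.val.comp (UniversalEnvelopingAlgebra.lift K g)
      = UniversalEnvelopingAlgebra.lift K f := by
    refine (UniversalEnvelopingAlgebra.lift_unique K f _).1 (funext fun x => ?_)
    change ((UniversalEnvelopingAlgebra.lift K g (UniversalEnvelopingAlgebra.ι K x) : S) : B) = f x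
    rw [UniversalEnvelopingAlgebra.lift_ι_apply]
    rfl
  rw [← hg]
  exact (UniversalEnvelopingAlgebra.lift K g u).2

theorem op_commute [CharZero K] (μ : Fin n → K) {i j : Fin n} (hij : i ≠ j) (x y : Su11 K) :
    Commute (x 0 • opJPlus i + x 1 • opJMinus μ i + x 2 • opAZero μ i)
      (y 0 • opJPlus j + y 1 • opJMinus μ j + y 2 • opAZero μ j) := by
  have hr : ∀ a b : Fin n, a ≠ b → Commute (mulVar a * dunkl μ a) (mulVar b * dunkl μ b) :=
    fun a b h => ((mulVar_commute a b).mul_right (dunkl_mulVar_commute μ h.symm).symm).mul_left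
      ((dunkl_mulVar_commute μ h).mul_right (dunkl_commute μ a b))
  have he : ∀ a b : Fin n, Commute (euler a) (euler b : Module.End K (MvPolynomial (Fin n) K)) :=
    fun a b => LinearMap.ext fun p => MvPolynomial.ext _ _ fun m => by
      simp only [Module.End.mul_apply, coeff_euler]
      ring
  have hx : ∀ a b : Fin n, a ≠ b →
      Commute (euler a) (mulVar b : Module.End K (MvPolynomial (Fin n) K)) :=
    fun a b h => LinearMap.ext fun p => MvPolynomial.ext _ _ fun m => by
      simp only [Module.End.mul_apply, coeff_euler, coeff_mulVar, Finsupp.tsub_apply,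
        Finsupp.single_apply, Ne.symm h, if_false, tsub_zero]
      split_ifs <;> simp
  have ht : ∀ a b : Fin n, a ≠ b → Commute (euler a) (dunkl μ b) :=
    fun a b h => LinearMap.ext fun p => MvPolynomial.ext _ _ fun m => by
      simp only [Module.End.mul_apply, coeff_euler, coeff_dunkl, Finsupp.add_apply,
        Finsupp.single_apply, Ne.symm h, if_false, add_zero]
      ring
  have hA : ∀ (a : Fin n) (z : Module.End K (MvPolynomial (Fin n) K)), Commute (euler a) z →
      Commute (opAZero μ a) z :=
    fun a z h => (h.add_left ((Commute.one_left z).smul_left _)).smul_left _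
  have hPP : Commute (opJPlus i : Module.End K (MvPolynomial (Fin n) K)) (opJPlus j) :=
    (((mulVar_commute i j).pow_pow 2 2).smul_left _).smul_right _
  have hMM : Commute (opJMinus μ i) (opJMinus μ j) :=
    (((dunkl_commute μ i j).pow_pow 2 2).smul_left _).smul_right _
  have hMP : ∀ a b : Fin n, a ≠ b → Commute (opJMinus μ a) (opJPlus b) := fun a b h =>
    (((dunkl_mulVar_commute μ h).pow_pow 2 2).smul_left _).smul_right _
  have hAP : ∀ a b : Fin n, a ≠ b → Commute (opAZero μ a) (opJPlus b) := fun a b h =>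
    hA a _ (((hx a b h).pow_right 2).smul_right _)
  have hAM : ∀ a b : Fin n, a ≠ b → Commute (opAZero μ a) (opJMinus μ b) := fun a b h =>
    hA a _ (((ht a b h).pow_right 2).smul_right _)
  have hAA : Commute (opAZero μ i) (opAZero μ j) :=
    hA i _ (hA j _ (he j i)).symm
  refine Commute.add_left (Commute.add_left ?_ ?_) ?_ <;>
    refine Commute.smul_left ?_ _ <;>
    refine Commute.add_right (Commute.add_right ?_ ?_) ?_ <;>
    refine Commute.smul_right ?_ _
  · exact hPP
  · exact (hMP j i hij.symm).symm
  · exact (hAP j i hij.symm).symm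
  · exact hMP i j hij
  · exact hMM
  · exact (hAM j i hij.symm).symm
  · exact hAP i j hij
  · exact hAM i j hij
  · exact hAA

theorem dunklRepAt_commute [CharZero K] (μ : Fin n → K) :
    Pairwise fun i j : Fin n =>
      ∀ u v : USu11 K, Commute (dunklRepAt μ i u) (dunklRepAt μ j v) := by
  intro i j hij u v
  have h1 : ∀ (x : Su11 K) (v : USu11 K),
      Commute (x 0 • opJPlus i + x 1 • opJMinus μ i + x 2 • opAZero μ i) (dunklRepAt μ j v) := by
    intro x v
    have := lift_mem_of_forall (su11LieHom (opJPlus j) (opJMinus μ j) (opAZero μ j)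
      (op_relation₁ μ j) (op_relation₂ μ j) (op_relation₃ μ j))
      (Subalgebra.centralizer K {x 0 • opJPlus i + x 1 • opJMinus μ i + x 2 • opAZero μ i})
      (fun y => by
        rw [Subalgebra.mem_centralizer_iff]
        rintro z rfl
        exact op_commute μ hij x y) v
    exact (Subalgebra.mem_centralizer_iff K).1 this _ rfl
  have := lift_mem_of_forall (su11LieHom (opJPlus i) (opJMinus μ i) (opAZero μ i)
    (op_relation₁ μ i) (op_relation₂ μ i) (op_relation₃ μ i))
    (Subalgebra.centralizer K {dunklRepAt μ j v})
    (fun x => by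
      rw [Subalgebra.mem_centralizer_iff]
      rintro z rfl
      exact (h1 x v).symm) u
  exact ((Subalgebra.mem_centralizer_iff K).1 this _ rfl).symm

/-- The map `(u_1, …, u_n) ↦ π_1(u_1) ⋯ π_n(u_n)`, where `π_i` is the realization in the variable
`y_i`; the factors of the product commute pairwise. -/
def dunklMonoidHom [CharZero K] (μ : Fin n → K) :
    (Fin n → USu11 K) →* Module.End K (MvPolynomial (Fin n) K) :=
  MonoidHom.noncommPiCoprod (N := fun _ : Fin n => USu11 K)
    (fun i => ((dunklRepAt μ i).toRingHom.toMonoidHom :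
      USu11 K →* Module.End K (MvPolynomial (Fin n) K)))
    (dunklRepAt_commute μ)

theorem dunklMonoidHom_mulSingle [CharZero K] (μ : Fin n → K) (i : Fin n) (u : USu11 K) :
    dunklMonoidHom μ (Pi.mulSingle i u) = dunklRepAt μ i u :=
  MonoidHom.noncommPiCoprod_mulSingle (N := fun _ : Fin n => USu11 K)
    (fun i => ((dunklRepAt μ i).toRingHom.toMonoidHom :
      USu11 K →* Module.End K (MvPolynomial (Fin n) K)))
    (hcomm := dunklRepAt_commute μ) i u

theorem dunklMonoidHom_update [CharZero K] (μ : Fin n → K) (f : Fin n → USu11 K) (i : Fin n)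
    (u : USu11 K) : dunklMonoidHom μ (Function.update f i u)
      = dunklMonoidHom μ (Function.update f i 1) * dunklRepAt μ i u := by
  rw [← dunklMonoidHom_mulSingle, ← map_mul]
  congr 1
  funext k
  by_cases hk : k = i
  · subst hk
    simp
  · simp [hk]

/-- The Dunkl-operator realization of the `n`-fold tensor power of `U(su(1,1))` on polynomials in
`y_1, …, y_n`: the `i`-th tensor factor acts by the operators in the variable `y_i`, so that
`u_1 ⊗ ⋯ ⊗ u_n` acts as the product of the (pairwise commuting) actions of the `u_i`. -/
def dunklRep [CharZero K] (μ : Fin n → K) :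
    TensorU K n →ₐ[K] Module.End K (MvPolynomial (Fin n) K) :=
  PiTensorProduct.liftAlgHom (R := K) (A := fun _ : Fin n => USu11 K)
    { toFun := dunklMonoidHom μ
      map_update_add' := by
        intro inst f i u v
        obtain rfl : inst = instDecidableEqFin n := Subsingleton.elim _ _
        rw [dunklMonoidHom_update, dunklMonoidHom_update μ f i u, dunklMonoidHom_update μ f i v,
          map_add, mul_add]
      map_update_smul' := by
        intro inst f i c u
        obtain rfl : inst = instDecidableEqFin n := Subsingleton.elim _ _
        rw [dunklMonoidHom_update, dunklMonoidHom_update μ f i u, map_smul, mul_smul_comm] }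
    (map_one (dunklMonoidHom μ)) (map_mul (dunklMonoidHom μ))

/-- The `ℤ₂ⁿ` Dunkl-Laplacian `Δ = ∑ T_i²`. -/
def dunklLaplacian (μ : Fin n → K) : Module.End K (MvPolynomial (Fin n) K) :=
  ∑ i, dunkl μ i ^ 2

/-- The space of Dunkl-harmonics that are homogeneous polynomials of degree `a` and on which the
reflection `r_i` acts as `(-1) ^ ε_i` for every `i`. -/
def dunklHarmonics (μ : Fin n → K) (a : ℕ) (ε : Fin n → Fin 2) :
    Submodule K (MvPolynomial (Fin n) K) :=
  LinearMap.ker (dunklLaplacian μ) ⊓ homogeneousSubmodule (Fin n) K a ⊓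
    ⨅ i, Module.End.eigenspace (reflection i) ((-1) ^ (ε i : ℕ))

end Dunkl

/-- Let `ρ` be a representation of an algebra `A` on `V`, let `R` be a subalgebra of `A` and `W` a
subspace of `V`. Then `W` is an irreducible representation of `R` if it is stable under `R`,
is nonzero, and has no `R`-stable subspaces other than `0` and `W`. -/
structure IsIrreducibleOn {K A V : Type*} [Field K] [Ring A] [Algebra K A] [AddCommGroup V]
    [Module K V] (ρ : A →ₐ[K] Module.End K V) (R : Subalgebra K A) (W : Submodule K V) : Prop where
  stable : ∀ x ∈ R, ∀ v ∈ W, ρ x v ∈ W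
  ne_bot : W ≠ ⊥
  eq_bot_or_eq : ∀ U : Submodule K V, U ≤ W → (∀ x ∈ R, ∀ v ∈ U, ρ x v ∈ U) → U = ⊥ ∨ U = W

end RacahDunkl

end

/-!
Everything is read off from the monomial basis. On polynomials, `C_A` becomes
`α_A² - α_A - P_A M_A`, where `α_A` is diagonal on monomials, `P_A = ½ ∑ y_i²` and
`M_A = ½ ∑ T_i²` with sums over `i ∈ A`; each `T_i²` lowers the exponent of `y_i` by two, with a
coefficient that is nonzero unless the result has to vanish, because the `μ_i` are positive.
Stability of the space `H` of harmonics holds because `C_A` commutes with `Δ` and preserves degree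
and parities.

For irreducibility, fix a variable `y_l` and let `δ` be the functional that takes the coefficient
of the monomial with the highest power of `y_l` among those of the degree and parities of `H`.

* `δ` does not vanish on a nonzero stable subspace `U`: the operators `C_{i,l}` raise the power of
  `y_l` as long as some `y_i²` divides a monomial that occurs
  (`exists_coeff_ne_zero_of_stable`).
* `δ` is an eigenvector of the transpose of `C_B`, where `B` is the complement of `l`. By finite
  dimension, the eigenvalue occurs on `U` too: `U` contains an eigenvector of `C_B`, a zonal vector
  (`exists_zonal_of_stable`).
* A zonal vector in `H` is determined by its value under `δ` (`eq_zero_of_zonal`), so the zonal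
  vectors form at most a line.
* There is a positive definite inner product for which `T_i` is adjoint to `y_i`; all `C_A` are
  symmetric for it (`isAdjointPair_casimirAt`), hence a proper stable subspace `U ≠ 0` has a nonzero
  stable orthogonal complement (`exists_stable_orthogonal`).

The line of zonal vectors would lie in `U` and in its orthogonal complement, which is absurd.
That `H` is nonzero uses an explicit alternating sum in two of the variables
(`dunklHarmonics_ne_bot`).
-/

namespace RacahDunkl

/-! ### The Casimir operators commute with the total lowering operator -/

section Casimir

variable {K : Type*} [Field K] {n : ℕ}

theorem commute_casimir_jMinus :
    Commute (casimir K) (UniversalEnvelopingAlgebra.ι K (jMinus K)) := by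
  have h₁ := (UniversalEnvelopingAlgebra.ι K).map_lie (jMinus K) (jPlus K)
  have h₃ := (UniversalEnvelopingAlgebra.ι K).map_lie (aZero K) (jMinus K)
  rw [lie_jMinus_jPlus, LieRing.of_associative_ring_bracket, map_smul, two_smul] at h₁
  rw [lie_aZero_jMinus, LieRing.of_associative_ring_bracket, map_neg] at h₃
  unfold casimir Commute SemiconjBy
  generalize UniversalEnvelopingAlgebra.ι K (jMinus K) = M at *
  generalize UniversalEnvelopingAlgebra.ι K (jPlus K) = P at *
  generalize UniversalEnvelopingAlgebra.ι K (aZero K) = A at *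
  have hMA : M * A = A * M + M := by
    rw [eq_sub_iff_add_eq] at h₃
    rw [← h₃]
    abel
  have hMP : M * P = P * M + (A + A) := by
    rw [eq_sub_iff_add_eq] at h₁
    rw [← h₁]
    abel
  have hMAA : M * (A * A) = A * (A * M) + (A * M) + (A * M) + M := by
    rw [← mul_assoc, hMA, add_mul, mul_assoc, hMA, mul_add]
    abel
  rw [pow_two, sub_mul, sub_mul, mul_sub, mul_sub, hMAA, hMA, ← mul_assoc M P M, hMP, add_mul,
    add_mul, mul_assoc A A M]
  abel

theorem diagLie_apply (A : Finset (Fin n)) (x : Su11 K) :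
    diagLie A x = ∑ i ∈ A, slot i (UniversalEnvelopingAlgebra.ι K x) := by
  change (∑ i ∈ A, (slot i).toLinearMap ∘ₗ
    (UniversalEnvelopingAlgebra.ι K : Su11 K →ₗ⁅K⁆ USu11 K).toLinearMap) x = _
  rw [LinearMap.sum_apply]
  rfl

theorem diag_ι (A : Finset (Fin n)) (x : Su11 K) :
    diag A (UniversalEnvelopingAlgebra.ι K x)
      = ∑ i ∈ A, slot i (UniversalEnvelopingAlgebra.ι K x) := by
  rw [diag, UniversalEnvelopingAlgebra.lift_ι_apply, diagLie_apply]

theorem commute_diag_slot {A : Finset (Fin n)} {j : Fin n} (hj : j ∉ A) (u v : USu11 K) :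
    Commute (diag A u) (slot j v) := by
  have := lift_mem_of_forall (diagLie A) (Subalgebra.centralizer K {slot j v})
    (fun x => by
      rw [Subalgebra.mem_centralizer_iff]
      rintro z rfl
      rw [diagLie_apply]
      exact Commute.sum_right _ _ _ fun i hi =>
        commute_slot (ne_of_mem_of_not_mem hi hj).symm _ _) u
  exact ((Subalgebra.mem_centralizer_iff K).1 this _ rfl).symm

theorem commute_casimirAt_jMinus (A : Finset (Fin n)) :
    Commute (casimirAt A : TensorU K n)
      (diag Finset.univ (UniversalEnvelopingAlgebra.ι K (jMinus K))) := by
  rw [diag_ι, ← Finset.sum_add_sum_compl A, ← diag_ι]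
  refine (commute_casimir_jMinus.map (diag A)).add_right ?_
  exact Commute.sum_right _ _ _ fun j hj =>
    commute_diag_slot (Finset.mem_compl.1 hj) _ _

theorem casimirAt_mem_racahAlgebra (A : Finset (Fin n)) :
    (casimirAt A : TensorU K n) ∈ racahAlgebra K n :=
  Algebra.subset_adjoin ⟨A, rfl⟩

variable [CharZero K] (μ : Fin n → K)

theorem dunklRep_slot (i : Fin n) (u : USu11 K) :
    dunklRep μ (slot i u) = dunklRepAt μ i u := by
  rw [dunklRep, slot, PiTensorProduct.liftAlgHom_apply, PiTensorProduct.singleAlgHom_apply,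
    PiTensorProduct.lift.tprod]
  exact dunklMonoidHom_mulSingle μ i u

theorem dunklRepAt_ι (i : Fin n) (x : Su11 K) :
    dunklRepAt μ i (UniversalEnvelopingAlgebra.ι K x)
      = x 0 • opJPlus i + x 1 • opJMinus μ i + x 2 • opAZero μ i := by
  rw [dunklRepAt, UniversalEnvelopingAlgebra.lift_ι_apply]
  rfl

theorem dunklRep_diag_jPlus (A : Finset (Fin n)) :
    dunklRep μ (diag A (UniversalEnvelopingAlgebra.ι K (jPlus K))) = ∑ i ∈ A, opJPlus i := by
  simp only [diag_ι, map_sum, dunklRep_slot, dunklRepAt_ι]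
  simp [jPlus]

theorem dunklRep_diag_jMinus (A : Finset (Fin n)) :
    dunklRep μ (diag A (UniversalEnvelopingAlgebra.ι K (jMinus K))) = ∑ i ∈ A, opJMinus μ i := by
  simp only [diag_ι, map_sum, dunklRep_slot, dunklRepAt_ι]
  simp [jMinus]

theorem dunklRep_diag_aZero (A : Finset (Fin n)) :
    dunklRep μ (diag A (UniversalEnvelopingAlgebra.ι K (aZero K))) = ∑ i ∈ A, opAZero μ i := by
  simp only [diag_ι, map_sum, dunklRep_slot, dunklRepAt_ι]
  simp [aZero]

theorem dunklRep_casimirAt (A : Finset (Fin n)) :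
    dunklRep μ (casimirAt A) = (∑ i ∈ A, opAZero μ i) ^ 2 - ∑ i ∈ A, opAZero μ i
      - (∑ i ∈ A, opJPlus i) * ∑ i ∈ A, opJMinus μ i := by
  rw [casimirAt, casimir, map_sub, map_sub, map_sub, map_sub, map_mul, map_mul, map_pow, map_pow,
    dunklRep_diag_jPlus, dunklRep_diag_jMinus, dunklRep_diag_aZero]

theorem dunklLaplacian_eq :
    dunklLaplacian μ
      = (2 : K) • dunklRep μ (diag Finset.univ (UniversalEnvelopingAlgebra.ι K (jMinus K))) := by
  rw [dunklRep_diag_jMinus, dunklLaplacian, Finset.smul_sum]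
  refine Finset.sum_congr rfl fun i _ => ?_
  rw [opJMinus, smul_smul, mul_inv_cancel₀ two_ne_zero, one_smul]

theorem commute_dunklRep_casimirAt_dunklLaplacian (A : Finset (Fin n)) :
    Commute (dunklRep μ (casimirAt A)) (dunklLaplacian μ) := by
  rw [dunklLaplacian_eq]
  exact ((commute_casimirAt_jMinus A).map (dunklRep μ)).smul_right _

/-- Stability under `R(n)` can be tested on the generators `C_A`. -/
theorem racahAlgebra_stable {U : Submodule K (MvPolynomial (Fin n) K)}
    (h : ∀ A : Finset (Fin n), ∀ v ∈ U, dunklRep μ (casimirAt A) v ∈ U) :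
    ∀ x ∈ racahAlgebra K n, ∀ v ∈ U, dunklRep μ x v ∈ U := by
  intro x hx
  induction hx using Algebra.adjoin_induction with
  | mem x hx =>
    obtain ⟨A, rfl⟩ := hx
    exact h A
  | algebraMap r =>
    intro v hv
    rw [AlgHom.commutes]
    exact U.smul_mem r hv
  | add x y _ _ hx hy =>
    intro v hv
    rw [map_add]
    exact U.add_mem (hx v hv) (hy v hv)
  | mul x y _ _ hx hy =>
    intro v hv
    rw [map_mul]
    exact hx _ (hy v hv)

end Casimir

/-! ### Matrix coefficients in the monomial basis -/

section Coefficients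

variable {K : Type*} [Field K] {n : ℕ}

/-- The coefficient in `T_i y_i ^ (k + 1) = dunklCoeff μ i k • y_i ^ k`. -/
def dunklCoeff (μ : Fin n → K) (i : Fin n) (k : ℕ) : K :=
  (k + 1 : ℕ) + μ i * (1 - (-1) ^ (k + 1))

/-- The eigenvalue on the monomial `y ^ m` of the diagonal embedding of `A₀` at the places
in `A`. -/
def weightAt (μ : Fin n → K) (A : Finset (Fin n)) (m : Fin n →₀ ℕ) : K :=
  ∑ i ∈ A, (2 : K)⁻¹ * (m i + ((2 : K)⁻¹ + μ i))

theorem coeff_dunkl_sq (μ : Fin n → K) (i : Fin n) (p : MvPolynomial (Fin n) K)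
    (m : Fin n →₀ ℕ) :
    coeff m ((dunkl μ i ^ 2) p) = dunklCoeff μ i (m i) * dunklCoeff μ i (m i + 1)
      * coeff (m + Finsupp.single i 2) p := by
  rw [pow_two, Module.End.mul_apply, coeff_dunkl, coeff_dunkl, add_assoc, ← Finsupp.single_add,
    Finsupp.add_apply, Finsupp.single_eq_same, dunklCoeff, dunklCoeff, mul_assoc]

theorem coeff_opJMinus (μ : Fin n → K) (i : Fin n) (p : MvPolynomial (Fin n) K)
    (m : Fin n →₀ ℕ) :
    coeff m (opJMinus μ i p) = 2⁻¹ * (dunklCoeff μ i (m i) * dunklCoeff μ i (m i + 1)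
      * coeff (m + Finsupp.single i 2) p) := by
  rw [opJMinus, LinearMap.smul_apply, coeff_smul, coeff_dunkl_sq, smul_eq_mul]

theorem coeff_opJPlus (i : Fin n) (p : MvPolynomial (Fin n) K) (m : Fin n →₀ ℕ) :
    coeff m (opJPlus i p)
      = if 2 ≤ m i then 2⁻¹ * coeff (m - Finsupp.single i 2) p else 0 := by
  rw [opJPlus, LinearMap.smul_apply, coeff_smul, pow_two, Module.End.mul_apply, coeff_mulVar,
    coeff_mulVar, tsub_tsub, ← Finsupp.single_add, smul_eq_mul, Finsupp.tsub_apply,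
    Finsupp.single_eq_same]
  rcases Nat.lt_or_ge (m i) 2 with h | h
  · rw [if_neg (by lia : ¬ 2 ≤ m i)]
    split_ifs <;> lia
  · rw [if_neg (by lia), if_neg (by lia), if_pos h]

theorem coeff_sum_opAZero (μ : Fin n → K) (A : Finset (Fin n)) (p : MvPolynomial (Fin n) K)
    (m : Fin n →₀ ℕ) :
    coeff m ((∑ i ∈ A, opAZero μ i) p) = weightAt μ A m * coeff m p := by
  rw [LinearMap.sum_apply, coeff_sum, weightAt, Finset.sum_mul]
  refine Finset.sum_congr rfl fun i _ => ?_
  simp only [opAZero, LinearMap.smul_apply, LinearMap.add_apply, coeff_smul, coeff_add,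
    coeff_euler, Module.End.one_apply, smul_eq_mul]
  ring

theorem coeff_sum_opJPlus (A : Finset (Fin n)) (p : MvPolynomial (Fin n) K) (m : Fin n →₀ ℕ) :
    coeff m ((∑ i ∈ A, opJPlus i) p)
      = ∑ i ∈ A, if 2 ≤ m i then 2⁻¹ * coeff (m - Finsupp.single i 2) p else 0 := by
  rw [LinearMap.sum_apply, coeff_sum]
  exact Finset.sum_congr rfl fun i _ => coeff_opJPlus i p m

theorem coeff_sum_opJMinus (μ : Fin n → K) (A : Finset (Fin n)) (p : MvPolynomial (Fin n) K)
    (m : Fin n →₀ ℕ) :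
    coeff m ((∑ i ∈ A, opJMinus μ i) p)
      = ∑ i ∈ A, 2⁻¹ * (dunklCoeff μ i (m i) * dunklCoeff μ i (m i + 1)
        * coeff (m + Finsupp.single i 2) p) := by
  rw [LinearMap.sum_apply, coeff_sum]
  exact Finset.sum_congr rfl fun i _ => coeff_opJMinus μ i p m

theorem coeff_dunklRep_casimirAt [CharZero K] (μ : Fin n → K) (A : Finset (Fin n))
    (p : MvPolynomial (Fin n) K) (m : Fin n →₀ ℕ) :
    coeff m (dunklRep μ (casimirAt A) p) = (weightAt μ A m ^ 2 - weightAt μ A m) * coeff m p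
      - coeff m ((∑ i ∈ A, opJPlus i) ((∑ i ∈ A, opJMinus μ i) p)) := by
  rw [dunklRep_casimirAt, LinearMap.sub_apply, LinearMap.sub_apply, coeff_sub, coeff_sub, pow_two,
    Module.End.mul_apply, Module.End.mul_apply, coeff_sum_opAZero, coeff_sum_opAZero]
  ring

end Coefficients

section Positivity

variable {𝕜 : Type*} [RCLike 𝕜] {n : ℕ} {μ : Fin n → ℝ}

theorem dunklCoeff_pos (hμ : ∀ i, 0 < μ i) (i : Fin n) (k : ℕ) : 0 < dunklCoeff μ i k := by
  have h1 : (-1 : ℝ) ^ (k + 1) ≤ 1 := by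
    rcases neg_one_pow_eq_or ℝ (k + 1) with h | h <;> rw [h]
    norm_num
  have h2 : 0 ≤ μ i * (1 - (-1) ^ (k + 1)) := mul_nonneg (hμ i).le (sub_nonneg.2 h1)
  have h3 : (0 : ℝ) < (k + 1 : ℕ) := by positivity
  exact add_pos_of_pos_of_nonneg h3 h2

theorem dunklCoeff_ofReal (i : Fin n) (k : ℕ) :
    dunklCoeff (fun i => (μ i : 𝕜)) i k = ((dunklCoeff μ i k : ℝ) : 𝕜) := by
  simp [dunklCoeff]

theorem dunklCoeff_ne_zero (hμ : ∀ i, 0 < μ i) (i : Fin n) (k : ℕ) :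
    dunklCoeff (fun i => (μ i : 𝕜)) i k ≠ 0 := by
  rw [dunklCoeff_ofReal]
  exact RCLike.ofReal_ne_zero.2 (dunklCoeff_pos hμ i k).ne'

theorem weightAt_ofReal (A : Finset (Fin n)) (m : Fin n →₀ ℕ) :
    weightAt (fun i => (μ i : 𝕜)) A m = ((weightAt μ A m : ℝ) : 𝕜) := by
  rw [weightAt, weightAt, RCLike.ofReal_sum]
  refine Finset.sum_congr rfl fun i _ => ?_
  rw [RCLike.ofReal_mul, RCLike.ofReal_add, RCLike.ofReal_add, RCLike.ofReal_inv,
    RCLike.ofReal_natCast, RCLike.ofReal_ofNat]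

end Positivity

/-! ### Dunkl harmonics in coordinates -/

section Harmonics

variable {K : Type*} [Field K] [CharZero K] {n : ℕ} {μ : Fin n → K} {a : ℕ} {ε : Fin n → Fin 2}

/-- The exponents of the monomials of degree `a` on which `r_i` acts as `(-1) ^ ε_i`. -/
def IsExponent (a : ℕ) (ε : Fin n → Fin 2) (m : Fin n →₀ ℕ) : Prop :=
  ∑ i, m i = a ∧ ∀ i, m i % 2 = (ε i : ℕ)

theorem mem_dunklHarmonics_iff {p : MvPolynomial (Fin n) K} :
    p ∈ dunklHarmonics μ a ε
      ↔ dunklLaplacian μ p = 0 ∧ ∀ m, coeff m p ≠ 0 → IsExponent a ε m := by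
  have hr : ∀ i, reflection i p = ((-1 : K) ^ (ε i : ℕ)) • p
      ↔ ∀ m, coeff m p ≠ 0 → m i % 2 = (ε i : ℕ) := by
    intro i
    have hε := (ε i).isLt
    rw [MvPolynomial.ext_iff]
    refine forall_congr' fun m => ?_
    rw [coeff_reflection, coeff_smul, smul_eq_mul, mul_eq_mul_right_iff, or_iff_not_imp_right,
      ← ne_eq]
    refine imp_congr_right fun _ => ?_
    rw [neg_one_pow_eq_pow_mod_two (n := m i)]
    have h2 := Nat.mod_lt (m i) two_pos
    have hne : (-1 : K) ≠ 1 := by norm_num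
    interval_cases m i % 2 <;> interval_cases (ε i : ℕ) <;> simp [hne, hne.symm]
  simp only [dunklHarmonics, Submodule.mem_inf, Submodule.mem_iInf, LinearMap.mem_ker,
    Module.End.mem_eigenspace_iff, hr, mem_homogeneousSubmodule, and_assoc, IsExponent]
  have hw : ∀ m : Fin n →₀ ℕ, Finsupp.weight (1 : Fin n → ℕ) m = ∑ i, m i := fun m => by
    rw [← Finsupp.degree_eq_sum]
    exact (DFunLike.congr_fun Finsupp.degree_eq_weight_one m).symm
  refine and_congr_right fun _ => ⟨fun h m hm => ⟨?_, fun i => h.2 i m hm⟩,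
    fun h => ⟨fun m hm => ?_, fun i m hm => (h m hm).2 i⟩⟩
  · rw [← h.1 hm, hw]
  · rw [← (h m hm).1, hw]

theorem IsExponent.le {m : Fin n →₀ ℕ} (h : IsExponent a ε m) (i : Fin n) : (ε i : ℕ) ≤ m i :=
  h.2 i ▸ Nat.mod_le _ _

theorem IsExponent.exists_eq {m : Fin n →₀ ℕ} (h : IsExponent a ε m) :
    ∃ N, a = ∑ i, (ε i : ℕ) + 2 * N := by
  refine ⟨∑ i, m i / 2, ?_⟩
  rw [← h.1, Finset.mul_sum, ← Finset.sum_add_distrib]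
  refine Finset.sum_congr rfl fun i _ => ?_
  rw [← h.2 i, Nat.mod_add_div]

theorem sum_apply_tsub_add_single {m : Fin n →₀ ℕ} {i j : Fin n} (hi : 2 ≤ m i) :
    ∑ k, (m - Finsupp.single i 2 + Finsupp.single j 2 : Fin n →₀ ℕ) k = ∑ k, m k := by
  have h : Finsupp.single i 2 ≤ m := Finsupp.single_le_iff.2 hi
  have h1 := congrArg Finsupp.degree (tsub_add_cancel_of_le h)
  rw [map_add, Finsupp.degree_single] at h1
  rw [← Finsupp.degree_eq_sum, ← Finsupp.degree_eq_sum, map_add, Finsupp.degree_single, h1]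

theorem isExponent_tsub_add_single {m : Fin n →₀ ℕ} {i j : Fin n} (hi : 2 ≤ m i) :
    IsExponent a ε (m - Finsupp.single i 2 + Finsupp.single j 2) ↔ IsExponent a ε m := by
  rw [IsExponent, IsExponent, sum_apply_tsub_add_single hi]
  refine and_congr_right fun _ => forall_congr' fun k => ?_
  simp only [Finsupp.add_apply, Finsupp.tsub_apply, Finsupp.single_apply]
  split_ifs <;> subst_vars <;> lia

theorem casimirAt_mem_dunklHarmonics (A : Finset (Fin n)) {p : MvPolynomial (Fin n) K}
    (hp : p ∈ dunklHarmonics μ a ε) : dunklRep μ (casimirAt A) p ∈ dunklHarmonics μ a ε := by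
  rw [mem_dunklHarmonics_iff] at hp ⊢
  refine ⟨?_, fun m hm => ?_⟩
  · rw [← Module.End.mul_apply, ← (commute_dunklRep_casimirAt_dunklLaplacian μ A).eq,
      Module.End.mul_apply, hp.1, map_zero]
  · by_contra hne
    have h0 : ∀ m', ¬ IsExponent a ε m' → coeff m' p = 0 := fun m' h' => by
      by_contra h
      exact h' (hp.2 m' h)
    refine hm ?_
    rw [coeff_dunklRep_casimirAt, h0 m hne, mul_zero, zero_sub, neg_eq_zero, coeff_sum_opJPlus]
    refine Finset.sum_eq_zero fun i _ => ?_
    split_ifs with hi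
    · rw [coeff_sum_opJMinus, Finset.sum_eq_zero, mul_zero]
      intro j _
      rw [h0 _ (fun h => hne ((isExponent_tsub_add_single hi).1 h)), mul_zero, mul_zero]
    · rfl

theorem dunklHarmonics_eq_bot (h : ¬ ∃ N, a = ∑ i, (ε i : ℕ) + 2 * N) :
    dunklHarmonics μ a ε = ⊥ := by
  rw [Submodule.eq_bot_iff]
  intro p hp
  ext m
  rw [coeff_zero]
  by_contra hm
  exact h ((mem_dunklHarmonics_iff.1 hp).2 m hm).exists_eq

instance finiteDimensional_dunklHarmonics : FiniteDimensional K (dunklHarmonics μ a ε) := by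
  refine Submodule.finiteDimensional_of_le (S₂ := restrictTotalDegree (Fin n) K a) fun p hp => ?_
  rw [mem_restrictTotalDegree]
  exact (show p.IsHomogeneous a from hp.1.2).totalDegree_le

end Harmonics

/-! ### The Dunkl inner product -/

section InnerProduct

variable {n : ℕ} (μ : Fin n → ℝ)

/-- The squared norm of the monomial `y ^ m` in the inner product for which multiplication by
`y_i` and the Dunkl operator `T_i` are adjoint to each other. -/
noncomputable def monomialNormSq (m : Fin n →₀ ℕ) : ℝ :=
  ∏ i, ∏ k ∈ Finset.range (m i), dunklCoeff μ i k

variable {μ}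

theorem monomialNormSq_add_single (m : Fin n →₀ ℕ) (i : Fin n) :
    monomialNormSq μ (m + Finsupp.single i 1) = monomialNormSq μ m * dunklCoeff μ i (m i) := by
  have h : ∀ j, ∏ k ∈ Finset.range ((m + Finsupp.single i 1 : Fin n →₀ ℕ) j), dunklCoeff μ j k
      = (∏ k ∈ Finset.range (m j), dunklCoeff μ j k)
        * if i = j then dunklCoeff μ j (m j) else 1 := by
    intro j
    rw [Finsupp.add_apply, Finsupp.single_apply]
    split_ifs
    · rw [Finset.prod_range_succ]
    · rw [add_zero, mul_one]
  simp only [monomialNormSq, h]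
  rw [Finset.prod_mul_distrib, Finset.prod_ite_eq, if_pos (Finset.mem_univ i)]

end InnerProduct

section Form

variable {𝕜 : Type*} [RCLike 𝕜] {n : ℕ} {μ : Fin n → ℝ} {a : ℕ} {ε : Fin n → Fin 2}

theorem monomialNormSq_pos (hμ : ∀ i, 0 < μ i) (m : Fin n →₀ ℕ) : 0 < monomialNormSq μ m :=
  Finset.prod_pos fun i _ => Finset.prod_pos fun k _ => dunklCoeff_pos hμ i k

theorem sum_support_eq_sum (p q : MvPolynomial (Fin n) 𝕜) {S : Finset (Fin n →₀ ℕ)}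
    (hS : p.support ⊆ S) :
    ∑ m ∈ p.support, (monomialNormSq μ m : 𝕜) * (coeff m p * starRingEnd 𝕜 (coeff m q))
      = ∑ m ∈ S, (monomialNormSq μ m : 𝕜) * (coeff m p * starRingEnd 𝕜 (coeff m q)) := by
  refine Finset.sum_subset hS fun m _ hm => ?_
  rw [notMem_support_iff.1 hm, zero_mul, mul_zero]

variable (𝕜 μ) in
/-- The Hermitian form on polynomials, linear in its first argument, for which the monomials are
orthogonal and multiplication by `y_i` is adjoint to the Dunkl operator `T_i`. -/
noncomputable def dunklForm : MvPolynomial (Fin n) 𝕜 →ₗ[𝕜] MvPolynomial (Fin n) 𝕜 →ₗ⋆[𝕜] 𝕜 :=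
  LinearMap.mk₂'ₛₗ (RingHom.id 𝕜) (starRingEnd 𝕜)
    (fun p q => ∑ m ∈ p.support,
      (monomialNormSq μ m : 𝕜) * (coeff m p * starRingEnd 𝕜 (coeff m q)))
    (fun p p' q => by
      rw [sum_support_eq_sum p q (Finset.subset_union_left (s₂ := p'.support)),
        sum_support_eq_sum p' q (Finset.subset_union_right (s₁ := p.support)),
        sum_support_eq_sum (p + p') q support_add, ← Finset.sum_add_distrib]
      refine Finset.sum_congr rfl fun m _ => ?_
      rw [coeff_add]
      ring)
    (fun c p q => by
      rw [sum_support_eq_sum (c • p) q support_smul, smul_eq_mul, Finset.mul_sum]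
      refine Finset.sum_congr rfl fun m _ => ?_
      rw [coeff_smul, smul_eq_mul, RingHom.id_apply]
      ring)
    (fun p q q' => by
      rw [← Finset.sum_add_distrib]
      refine Finset.sum_congr rfl fun m _ => ?_
      rw [coeff_add, map_add]
      ring)
    (fun c p q => by
      rw [smul_eq_mul, Finset.mul_sum]
      refine Finset.sum_congr rfl fun m _ => ?_
      rw [coeff_smul, smul_eq_mul, map_mul]
      ring)

theorem dunklForm_apply (p q : MvPolynomial (Fin n) 𝕜) {S : Finset (Fin n →₀ ℕ)}
    (hS : p.support ⊆ S) : dunklForm 𝕜 μ p q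
      = ∑ m ∈ S, (monomialNormSq μ m : 𝕜) * (coeff m p * starRingEnd 𝕜 (coeff m q)) :=
  sum_support_eq_sum p q hS

theorem dunklForm_monomial (s : Fin n →₀ ℕ) (c : 𝕜) (q : MvPolynomial (Fin n) 𝕜) :
    dunklForm 𝕜 μ (monomial s c) q
      = (monomialNormSq μ s : 𝕜) * (c * starRingEnd 𝕜 (coeff s q)) := by
  rw [dunklForm_apply _ _ support_monomial_subset, Finset.sum_singleton, coeff_monomial,
    if_pos rfl]

theorem conj_dunklForm (p q : MvPolynomial (Fin n) 𝕜) :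
    starRingEnd 𝕜 (dunklForm 𝕜 μ p q) = dunklForm 𝕜 μ q p := by
  rw [dunklForm_apply p q (Finset.subset_union_left (s₂ := q.support)),
    dunklForm_apply q p (Finset.subset_union_right (s₁ := p.support)), map_sum]
  refine Finset.sum_congr rfl fun m _ => ?_
  rw [map_mul, map_mul, RCLike.conj_conj, RCLike.conj_ofReal, mul_comm (coeff m q)]

theorem dunklForm_self (p : MvPolynomial (Fin n) 𝕜) :
    dunklForm 𝕜 μ p p = ((∑ m ∈ p.support, monomialNormSq μ m * ‖coeff m p‖ ^ 2 : ℝ) : 𝕜) := by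
  rw [dunklForm_apply p p subset_rfl, RCLike.ofReal_sum]
  refine Finset.sum_congr rfl fun m _ => ?_
  rw [RCLike.mul_conj]
  norm_cast

theorem eq_zero_of_dunklForm_self (hμ : ∀ i, 0 < μ i) {p : MvPolynomial (Fin n) 𝕜}
    (h : dunklForm 𝕜 μ p p = 0) : p = 0 := by
  rw [dunklForm_self, RCLike.ofReal_eq_zero, Finset.sum_eq_zero_iff_of_nonneg
    fun m _ => mul_nonneg (monomialNormSq_pos hμ m).le (sq_nonneg _)] at h
  ext m
  by_contra hm
  have := h m (mem_support_iff.2 hm)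
  exact hm (by simpa [(monomialNormSq_pos hμ m).ne'] using this)

/-- The Dunkl form as a positive definite inner product, in Mathlib's convention of linearity in
the second argument. -/
noncomputable abbrev dunklCore (hμ : ∀ i, 0 < μ i) :
    InnerProductSpace.Core 𝕜 (MvPolynomial (Fin n) 𝕜) where
  inner p q := dunklForm 𝕜 μ q p
  conj_inner_symm p q := conj_dunklForm p q
  re_inner_nonneg p := by
    rw [dunklForm_self, RCLike.ofReal_re]
    exact Finset.sum_nonneg fun m _ => mul_nonneg (monomialNormSq_pos hμ m).le (sq_nonneg _)
  add_left p q r := map_add (dunklForm 𝕜 μ r) p q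
  smul_left p q c := LinearMap.map_smulₛₗ (dunklForm 𝕜 μ q) c p
  definite _ h := eq_zero_of_dunklForm_self hμ h

theorem isAdjointPair_mulVar (i : Fin n) : LinearMap.IsAdjointPair (dunklForm 𝕜 μ)
    (dunklForm 𝕜 μ) (mulVar i) (dunkl (fun i => (μ i : 𝕜)) i) := by
  intro p q
  induction p using MvPolynomial.induction_on' with
  | monomial s c =>
    have h : mulVar i (monomial s c) = monomial (s + Finsupp.single i 1) c := by
      change X i * monomial s c = _
      rw [X, monomial_mul, one_mul, add_comm]
    have hd := dunklCoeff_ofReal (𝕜 := 𝕜) (μ := μ) i (s i)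
    rw [dunklCoeff] at hd
    rw [h, dunklForm_monomial, dunklForm_monomial, monomialNormSq_add_single, coeff_dunkl, hd,
      map_mul, RCLike.conj_ofReal, RCLike.ofReal_mul]
    ring
  | add p p' hp hp' => rw [map_add, map_add, map_add, LinearMap.add_apply, LinearMap.add_apply,
      hp, hp']

theorem isAdjointPair_euler (i : Fin n) : LinearMap.IsAdjointPair (dunklForm 𝕜 μ)
    (dunklForm 𝕜 μ) (euler i) (euler i) := by
  intro p q
  rw [dunklForm_apply _ _ (Finset.subset_union_left (s₂ := p.support)),
    dunklForm_apply p _ (Finset.subset_union_right (s₁ := (euler i p).support))]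
  refine Finset.sum_congr rfl fun m _ => ?_
  rw [coeff_euler, coeff_euler, map_mul, map_natCast]
  ring

theorem isAdjointPair_ofReal_smul {f g : Module.End 𝕜 (MvPolynomial (Fin n) 𝕜)}
    (h : LinearMap.IsAdjointPair (dunklForm 𝕜 μ) (dunklForm 𝕜 μ) f g) {c : 𝕜}
    (hc : starRingEnd 𝕜 c = c) :
    LinearMap.IsAdjointPair (dunklForm 𝕜 μ) (dunklForm 𝕜 μ) (c • f) (c • g) := by
  intro p q
  rw [Pi.smul_apply, Pi.smul_apply, map_smul, LinearMap.smul_apply, h,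
    LinearMap.map_smulₛₗ (dunklForm 𝕜 μ p), hc]

theorem isAdjointPair_sub {f g f' g' : Module.End 𝕜 (MvPolynomial (Fin n) 𝕜)}
    (h : LinearMap.IsAdjointPair (dunklForm 𝕜 μ) (dunklForm 𝕜 μ) f g)
    (h' : LinearMap.IsAdjointPair (dunklForm 𝕜 μ) (dunklForm 𝕜 μ) f' g') :
    LinearMap.IsAdjointPair (dunklForm 𝕜 μ) (dunklForm 𝕜 μ) (f - f' : Module.End 𝕜 _)
      (g - g' : Module.End 𝕜 _) := by
  intro p q
  rw [LinearMap.sub_apply, LinearMap.sub_apply, map_sub, map_sub, LinearMap.sub_apply, h, h']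

theorem isAdjointPair_sum {f g : Fin n → Module.End 𝕜 (MvPolynomial (Fin n) 𝕜)}
    (A : Finset (Fin n))
    (h : ∀ i, LinearMap.IsAdjointPair (dunklForm 𝕜 μ) (dunklForm 𝕜 μ) (f i) (g i)) :
    LinearMap.IsAdjointPair (dunklForm 𝕜 μ) (dunklForm 𝕜 μ) (∑ i ∈ A, f i : Module.End 𝕜 _)
      (∑ i ∈ A, g i : Module.End 𝕜 _) := by
  intro p q
  rw [LinearMap.sum_apply, LinearMap.sum_apply, map_sum, map_sum, LinearMap.sum_apply]
  exact Finset.sum_congr rfl fun i _ => h i p q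

theorem conj_two_inv : starRingEnd 𝕜 (2 : 𝕜)⁻¹ = 2⁻¹ := by
  rw [map_inv₀, map_ofNat]

theorem isAdjointPair_opJPlus (i : Fin n) : LinearMap.IsAdjointPair (dunklForm 𝕜 μ)
    (dunklForm 𝕜 μ) (opJPlus i) (opJMinus (fun i => (μ i : 𝕜)) i) := by
  have h := (isAdjointPair_mulVar (𝕜 := 𝕜) (μ := μ) i).mul (isAdjointPair_mulVar i)
  rw [← pow_two, ← pow_two] at h
  exact isAdjointPair_ofReal_smul h conj_two_inv

theorem isAdjointPair_opJMinus (i : Fin n) : LinearMap.IsAdjointPair (dunklForm 𝕜 μ)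
    (dunklForm 𝕜 μ) (opJMinus (fun i => (μ i : 𝕜)) i) (opJPlus i) := by
  intro p q
  rw [← conj_dunklForm, ← isAdjointPair_opJPlus i q p, conj_dunklForm]

theorem isAdjointPair_opAZero (i : Fin n) : LinearMap.IsAdjointPair (dunklForm 𝕜 μ)
    (dunklForm 𝕜 μ) (opAZero (fun i => (μ i : 𝕜)) i) (opAZero (fun i => (μ i : 𝕜)) i) := by
  refine isAdjointPair_ofReal_smul ?_ conj_two_inv
  refine (isAdjointPair_euler i).add (isAdjointPair_ofReal_smul LinearMap.isAdjointPair_one ?_)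
  rw [map_add, conj_two_inv, RCLike.conj_ofReal]

/-- The Casimir operators are symmetric with respect to the Dunkl inner product. -/
theorem isAdjointPair_casimirAt (A : Finset (Fin n)) : LinearMap.IsAdjointPair (dunklForm 𝕜 μ)
    (dunklForm 𝕜 μ) (dunklRep (fun i => (μ i : 𝕜)) (casimirAt A))
    (dunklRep (fun i => (μ i : 𝕜)) (casimirAt A)) := by
  have hA := isAdjointPair_sum (𝕜 := 𝕜) (μ := μ) A isAdjointPair_opAZero
  have hP := isAdjointPair_sum (𝕜 := 𝕜) (μ := μ) A isAdjointPair_opJPlus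
  have hM := isAdjointPair_sum (𝕜 := 𝕜) (μ := μ) A isAdjointPair_opJMinus
  rw [dunklRep_casimirAt, pow_two]
  exact isAdjointPair_sub (isAdjointPair_sub (hA.mul hA) hA) (hP.mul hM)

/-- A proper stable subspace has a nonzero stable orthogonal complement. -/
theorem exists_stable_orthogonal (hμ : ∀ i, 0 < μ i)
    {U : Submodule 𝕜 (MvPolynomial (Fin n) 𝕜)}
    (hU : U ≤ dunklHarmonics (fun i => (μ i : 𝕜)) a ε)
    (hne : U ≠ dunklHarmonics (fun i => (μ i : 𝕜)) a ε)
    (hst : ∀ A : Finset (Fin n), ∀ v ∈ U, dunklRep (fun i => (μ i : 𝕜)) (casimirAt A) v ∈ U) :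
    ∃ V ≤ dunklHarmonics (fun i => (μ i : 𝕜)) a ε, V ≠ ⊥ ∧
      (∀ A : Finset (Fin n), ∀ v ∈ V, dunklRep (fun i => (μ i : 𝕜)) (casimirAt A) v ∈ V) ∧
      ∀ v ∈ V, ∀ u ∈ U, dunklForm 𝕜 μ v u = 0 := by
  let := (dunklCore (𝕜 := 𝕜) hμ).toNormedAddCommGroup
  let := InnerProductSpace.ofCore (dunklCore (𝕜 := 𝕜) hμ).toCore
  have : FiniteDimensional 𝕜 U := Submodule.finiteDimensional_of_le hU
  refine ⟨Uᗮ ⊓ dunklHarmonics (fun i => (μ i : 𝕜)) a ε, inf_le_right, fun h => hne ?_,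
    fun A v hv => ⟨?_, casimirAt_mem_dunklHarmonics A hv.2⟩, fun v hv u hu => ?_⟩
  · rw [← Submodule.sup_orthogonal_inf_of_hasOrthogonalProjection hU, h, sup_bot_eq]
  · refine (Submodule.mem_orthogonal _ _).2 fun u hu => ?_
    exact (isAdjointPair_casimirAt A v u).trans
      ((Submodule.mem_orthogonal _ _).1 hv.1 _ (hst A u hu))
  · exact (Submodule.mem_orthogonal _ _).1 hv.1 u hu

end Form

/-! ### Existence of harmonic polynomials -/

section Existence

variable {𝕜 : Type*} [RCLike 𝕜] {n : ℕ} {μ : Fin n → ℝ} {a : ℕ} {ε : Fin n → Fin 2}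

variable (𝕜 μ) in
/-- The monomial `y ^ m` divided by its squared norm; the Dunkl operators act on these by lowering
the exponents, without coefficients. -/
noncomputable def dividedMonomial (m : Fin n →₀ ℕ) : MvPolynomial (Fin n) 𝕜 :=
  monomial m ((monomialNormSq μ m : 𝕜)⁻¹)

theorem dunkl_dividedMonomial_add_single (hμ : ∀ i, 0 < μ i) (m : Fin n →₀ ℕ) (i : Fin n) :
    dunkl (fun i => (μ i : 𝕜)) i (dividedMonomial 𝕜 μ (m + Finsupp.single i 1))
      = dividedMonomial 𝕜 μ m := by
  ext m'
  have hd := dunklCoeff_ofReal (𝕜 := 𝕜) (μ := μ) i (m' i)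
  rw [dunklCoeff] at hd
  rw [coeff_dunkl, hd, dividedMonomial, dividedMonomial, coeff_monomial, coeff_monomial]
  by_cases h : m = m'
  · subst h
    have h1 : (monomialNormSq μ m : 𝕜) ≠ 0 := RCLike.ofReal_ne_zero.2 (monomialNormSq_pos hμ m).ne'
    have h2 : ((dunklCoeff μ i (m i) : ℝ) : 𝕜) ≠ 0 :=
      RCLike.ofReal_ne_zero.2 (dunklCoeff_pos hμ i _).ne'
    rw [if_pos rfl, if_pos rfl, monomialNormSq_add_single, RCLike.ofReal_mul]
    field_simp
  · rw [if_neg h, if_neg (fun h' => h (add_right_cancel h')), mul_zero]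

theorem dunkl_sq_dividedMonomial_add_single (hμ : ∀ i, 0 < μ i) (m : Fin n →₀ ℕ) (i : Fin n) :
    (dunkl (fun i => (μ i : 𝕜)) i ^ 2) (dividedMonomial 𝕜 μ (m + Finsupp.single i 2))
      = dividedMonomial 𝕜 μ m := by
  rw [pow_two, Module.End.mul_apply, show (2 : ℕ) = 1 + 1 from rfl, Finsupp.single_add,
    ← add_assoc, dunkl_dividedMonomial_add_single hμ, dunkl_dividedMonomial_add_single hμ]

theorem dunkl_sq_dividedMonomial_eq_zero {m : Fin n →₀ ℕ} {i : Fin n} (hm : m i < 2) :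
    (dunkl (fun i => (μ i : 𝕜)) i ^ 2) (dividedMonomial 𝕜 μ m) = 0 := by
  ext m'
  rw [coeff_dunkl_sq, dividedMonomial, coeff_monomial, if_neg, mul_zero, coeff_zero]
  rintro rfl
  simp at hm

/-- With `E` the divided monomials, the alternating sum of the
`E (ε + 2 k e_i + 2 (N - k) e_j)` is harmonic: its image under `T_i² + T_j²` telescopes, and the
other Dunkl operators square to zero on it. -/
theorem dunklHarmonics_ne_bot (hμ : ∀ i, 0 < μ i) {i j : Fin n} (hij : i ≠ j) (N : ℕ)
    (ha : a = ∑ i, (ε i : ℕ) + 2 * N) : dunklHarmonics (fun i => (μ i : 𝕜)) a ε ≠ ⊥ := by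
  let e : Fin n →₀ ℕ := Finsupp.equivFunOnFinite.symm fun k => (ε k : ℕ)
  have he : ∀ k, e k = (ε k : ℕ) := fun _ => rfl
  have he2 : ∀ k, e k < 2 := fun k => (ε k).isLt
  let s : ℕ → ℕ → (Fin n →₀ ℕ) := fun k k' =>
    e + Finsupp.single i (2 * k) + Finsupp.single j (2 * k')
  have hs_i : ∀ k k', s k k' i = e i + 2 * k := fun k k' => by simp [s, hij.symm]
  have hs_j : ∀ k k', s k k' j = e j + 2 * k' := fun k k' => by simp [s, hij]
  have hs_ne : ∀ k k' r, r ≠ i → r ≠ j → s k k' r = e r := fun k k' r hi hj => by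
    simp [s, hi.symm, hj.symm]
  let p : MvPolynomial (Fin n) 𝕜 :=
    ∑ k ∈ Finset.range (N + 1), (-1 : 𝕜) ^ k • dividedMonomial 𝕜 μ (s k (N - k))
  have hcoeff : ∀ m, coeff m p = ∑ k ∈ Finset.range (N + 1),
      (-1 : 𝕜) ^ k * if s k (N - k) = m then (monomialNormSq μ (s k (N - k)) : 𝕜)⁻¹ else 0 := by
    intro m
    rw [coeff_sum]
    refine Finset.sum_congr rfl fun k _ => ?_
    rw [coeff_smul, dividedMonomial, coeff_monomial, smul_eq_mul]
  have hi : (dunkl (fun i => (μ i : 𝕜)) i ^ 2) p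
      = ∑ k ∈ Finset.range N, (-1 : 𝕜) ^ (k + 1) • dividedMonomial 𝕜 μ (s k (N - (k + 1))) := by
    rw [map_sum, Finset.sum_range_succ', map_smul, dunkl_sq_dividedMonomial_eq_zero, smul_zero,
      add_zero]
    · refine Finset.sum_congr rfl fun k _ => ?_
      rw [map_smul, show s (k + 1) (N - (k + 1)) = s k (N - (k + 1)) + Finsupp.single i 2 by
        simp only [s]
        rw [mul_add, Finsupp.single_add, mul_one]
        abel, dunkl_sq_dividedMonomial_add_single hμ]
    · rw [hs_i]
      exact he2 i
  have hj : (dunkl (fun i => (μ i : 𝕜)) j ^ 2) p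
      = ∑ k ∈ Finset.range N, (-1 : 𝕜) ^ k • dividedMonomial 𝕜 μ (s k (N - (k + 1))) := by
    rw [map_sum, Finset.sum_range_succ, map_smul, dunkl_sq_dividedMonomial_eq_zero, smul_zero,
      add_zero]
    · refine Finset.sum_congr rfl fun k hk => ?_
      have hk' : N - k = N - (k + 1) + 1 := by
        have := Finset.mem_range.1 hk
        lia
      rw [map_smul, show s k (N - k) = s k (N - (k + 1)) + Finsupp.single j 2 by
        simp only [s]
        rw [hk', mul_add, Finsupp.single_add, mul_one]
        abel, dunkl_sq_dividedMonomial_add_single hμ]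
    · rw [hs_j, Nat.sub_self]
      exact he2 j
  have hr : ∀ r, r ≠ i ∧ r ≠ j → (dunkl (fun i => (μ i : 𝕜)) r ^ 2) p = 0 := by
    rintro r ⟨h1, h2⟩
    rw [map_sum]
    refine Finset.sum_eq_zero fun k _ => ?_
    rw [map_smul, dunkl_sq_dividedMonomial_eq_zero, smul_zero]
    rw [hs_ne _ _ r h1 h2]
    exact he2 r
  rw [Submodule.ne_bot_iff]
  refine ⟨p, mem_dunklHarmonics_iff.2 ⟨?_, fun m hm => ?_⟩, fun hp0 => ?_⟩
  · rw [dunklLaplacian, LinearMap.sum_apply, Fintype.sum_eq_add i j hij hr, hi, hj,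
      ← Finset.sum_add_distrib]
    refine Finset.sum_eq_zero fun k _ => ?_
    rw [pow_succ, mul_neg_one, neg_smul, neg_add_cancel]
  · rw [hcoeff] at hm
    obtain ⟨k, hk, hk0⟩ := Finset.exists_ne_zero_of_sum_ne_zero hm
    have hk' : k ≤ N := Nat.lt_succ_iff.1 (Finset.mem_range.1 hk)
    have hsm : s k (N - k) = m := by
      by_contra h
      rw [if_neg h, mul_zero] at hk0
      exact hk0 rfl
    subst hsm
    refine ⟨?_, fun r => ?_⟩
    · rw [← Finsupp.degree_eq_sum, map_add, map_add, Finsupp.degree_single, Finsupp.degree_single,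
        Finsupp.degree_eq_sum, ha]
      simp only [he]
      lia
    · have := he2 r
      rw [← he]
      by_cases h1 : r = i
      · rw [h1, hs_i]
        have := he2 i
        lia
      · by_cases h2 : r = j
        · rw [h2, hs_j]
          have := he2 j
          lia
        · rw [hs_ne _ _ r h1 h2]
          lia
  · have h := hcoeff (s 0 N)
    rw [hp0, coeff_zero, Finset.sum_eq_single 0] at h
    · rw [Nat.sub_zero, if_pos rfl, pow_zero, one_mul, zero_eq_inv] at h
      exact (RCLike.ofReal_ne_zero.2 (monomialNormSq_pos hμ _).ne') h.symm
    · intro k _ hk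
      rw [if_neg, mul_zero]
      intro h'
      have := DFunLike.congr_fun h' i
      rw [hs_i, hs_i] at this
      lia
    · intro h'
      exact absurd (Finset.mem_range.2 (Nat.succ_pos N)) h'

end Existence

/-! ### Zonal vectors in stable subspaces -/

section Zonal

variable {𝕜 : Type*} [RCLike 𝕜] {n : ℕ} {μ : Fin n → ℝ} {a : ℕ} {ε : Fin n → Fin 2}

/-- An exponent of a given degree is determined by its entries away from one place. -/
theorem IsExponent.ext_off {m m' : Fin n →₀ ℕ} (h : IsExponent a ε m) (h' : IsExponent a ε m')
    (l : Fin n) (hl : ∀ i, i ≠ l → m i = m' i) : m = m' := by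
  ext i
  by_cases hi : i = l
  · subst hi
    have h1 := h.1.trans h'.1.symm
    rw [← Finset.add_sum_erase _ _ (Finset.mem_univ i),
      ← Finset.add_sum_erase _ _ (Finset.mem_univ i),
      Finset.sum_congr rfl fun j hj => hl j (Finset.ne_of_mem_erase hj)] at h1
    exact Nat.add_right_cancel h1
  · exact hl i hi

/-- A nonzero subspace stable under `R(n)` contains a polynomial in which the highest power of
`y_l` allowed by the degree occurs. Indeed, `C_{i,l}` has a component that multiplies by `y_l²`
and lowers the degree in `y_i` by two with nonzero coefficients, so a monomial whose exponent
at `l` is maximal among all elements of the subspace cannot be divisible by `y_i²`. -/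
theorem exists_coeff_ne_zero_of_stable (hμ : ∀ i, 0 < μ i)
    {U : Submodule 𝕜 (MvPolynomial (Fin n) 𝕜)}
    (hU : U ≤ dunklHarmonics (fun i => (μ i : 𝕜)) a ε) (hU0 : U ≠ ⊥)
    (hst : ∀ A : Finset (Fin n), ∀ v ∈ U, dunklRep (fun i => (μ i : 𝕜)) (casimirAt A) v ∈ U)
    (l : Fin n) : ∃ p ∈ U, ∃ m, coeff m p ≠ 0 ∧ ∀ i, i ≠ l → m i = (ε i : ℕ) := by
  have hexp : ∀ p ∈ U, ∀ m, coeff m p ≠ 0 → IsExponent a ε m := fun p hp =>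
    (mem_dunklHarmonics_iff.1 (hU hp)).2
  let S : Set ℕ := {k | ∃ p ∈ U, ∃ m, coeff m p ≠ 0 ∧ m l = k}
  have hne : S.Nonempty := by
    obtain ⟨p, hp, hp0⟩ := U.ne_bot_iff.1 hU0
    obtain ⟨m, hm⟩ := MvPolynomial.ne_zero_iff.1 hp0
    exact ⟨m l, p, hp, m, hm, rfl⟩
  have hbdd : BddAbove S := by
    refine ⟨a, ?_⟩
    rintro k ⟨p, hp, m, hm, rfl⟩
    rw [← (hexp p hp m hm).1]
    exact Finset.single_le_sum (f := fun i => m i) (fun _ _ => Nat.zero_le _) (Finset.mem_univ l)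
  obtain ⟨p, hp, m, hm, hml⟩ := Nat.sSup_mem hne hbdd
  have hmax : ∀ q ∈ U, ∀ m', m l < m' l → coeff m' q = 0 := by
    intro q hq m' hlt
    by_contra h
    exact absurd (le_csSup hbdd ⟨q, hq, m', h, rfl⟩) (by lia)
  refine ⟨p, hp, m, hm, fun i hi => ?_⟩
  by_contra hne'
  have hi2 : 2 ≤ m i := by
    have h1 := (hexp p hp m hm).2 i
    lia
  -- In `C_{i,l} p`, the coefficient at `m - 2 e_i + 2 e_l` comes from `coeff m p` alone.
  have hc := hmax _ (hst {i, l} p hp) (m - Finsupp.single i 2 + Finsupp.single l 2)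
    (by simp [hi])
  rw [coeff_dunklRep_casimirAt, hmax p hp _ (by simp [hi]), mul_zero, zero_sub, neg_eq_zero,
    coeff_sum_opJPlus, Finset.sum_pair hi, coeff_sum_opJMinus, coeff_sum_opJMinus,
    Finset.sum_pair hi, Finset.sum_pair hi, add_tsub_cancel_right, tsub_add_cancel_of_le
      (Finsupp.single_le_iff.2 hi2),
    hmax p hp (m - Finsupp.single i 2 + Finsupp.single l 2) (by simp [hi]),
    hmax p hp (m - Finsupp.single i 2 + Finsupp.single l 2 - Finsupp.single i 2
      + Finsupp.single i 2) (by simp [hi]),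
    hmax p hp (m - Finsupp.single i 2 + Finsupp.single l 2 - Finsupp.single i 2
      + Finsupp.single l 2) (by simp [hi, add_assoc])] at hc
  simp [dunklCoeff_ne_zero hμ, hm] at hc

/-- The functional taking the coefficient of `y ^ m` is an eigenvector of the transpose of `C_A`
when no variable with index in `A` occurs in `y ^ m` with exponent at least two. -/
theorem coeff_dunklRep_casimirAt_of_lt {A : Finset (Fin n)} {m : Fin n →₀ ℕ}
    (hm : ∀ i ∈ A, m i < 2) (p : MvPolynomial (Fin n) 𝕜) :
    coeff m (dunklRep (fun i => (μ i : 𝕜)) (casimirAt A) p)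
      = (weightAt (fun i => (μ i : 𝕜)) A m ^ 2 - weightAt (fun i => (μ i : 𝕜)) A m)
        * coeff m p := by
  rw [coeff_dunklRep_casimirAt, coeff_sum_opJPlus, Finset.sum_eq_zero, sub_zero]
  intro i hi
  rw [if_neg (not_le.2 (hm i hi))]

/-- A harmonic polynomial that is zonal with respect to `y_l`, i.e. an eigenvector of
`C_{[n] ∖ {l}}` with the eigenvalue belonging to the lowest weight, vanishes as soon as its
coefficient at the highest power of `y_l` does. The part of highest degree in `y_l` is annihilated
by `∑_{i ≠ l} T_i²`, so the eigenvalue determines its degree in the remaining variables. -/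
theorem eq_zero_of_zonal (hμ : ∀ i, 0 < μ i) {l : Fin n} {m₀ : Fin n →₀ ℕ}
    (hm₀ : IsExponent a ε m₀) (hl : ∀ i, i ≠ l → m₀ i = (ε i : ℕ))
    {p : MvPolynomial (Fin n) 𝕜} (hp : p ∈ dunklHarmonics (fun i => (μ i : 𝕜)) a ε)
    (hC : dunklRep (fun i => (μ i : 𝕜)) (casimirAt (Finset.univ.erase l)) p
      = (weightAt (fun i => (μ i : 𝕜)) (Finset.univ.erase l) m₀ ^ 2
        - weightAt (fun i => (μ i : 𝕜)) (Finset.univ.erase l) m₀) • p)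
    (h0 : coeff m₀ p = 0) : p = 0 := by
  by_contra hp0
  obtain ⟨hΔ, hexp⟩ := mem_dunklHarmonics_iff.1 hp
  -- Maximal degree in `y_l` means minimal degree in the other variables.
  obtain ⟨m, hm, hmax⟩ := p.support.exists_max_image (fun m => m l) (support_nonempty.2 hp0)
  rw [mem_support_iff] at hm
  have hmax0 : ∀ m', m l < m' l → coeff m' p = 0 := fun m' hlt => by
    by_contra h
    exact absurd (hmax m' (mem_support_iff.2 h)) (not_le.2 hlt)
  have hM : ∀ m', m' l = m l →
      coeff m' ((∑ i ∈ Finset.univ.erase l, opJMinus (fun i => (μ i : 𝕜)) i) p) = 0 := by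
    intro m' hm'
    rw [dunklLaplacian_eq, dunklRep_diag_jMinus, LinearMap.smul_apply, smul_eq_zero_iff_right
      two_ne_zero, ← Finset.add_sum_erase _ _ (Finset.mem_univ l), LinearMap.add_apply] at hΔ
    have h := congrArg (coeff m') hΔ
    rwa [coeff_add, coeff_opJMinus, hmax0 (m' + Finsupp.single l 2) (by simp [hm']), mul_zero,
      mul_zero, zero_add, coeff_zero] at h
  have hcm := congrArg (coeff m) hC
  rw [coeff_dunklRep_casimirAt, coeff_sum_opJPlus, Finset.sum_eq_zero, sub_zero, coeff_smul,
    smul_eq_mul, mul_left_inj' hm, weightAt_ofReal, weightAt_ofReal] at hcm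
  · norm_cast at hcm
    have hne : m ≠ m₀ := fun h => hm (h ▸ h0)
    obtain ⟨i, hil, hi⟩ : ∃ i, i ≠ l ∧ m i ≠ m₀ i := by
      by_contra! h
      exact hne ((hexp m hm).ext_off hm₀ l h)
    have hi2 : m₀ i + 2 ≤ m i := by
      have h1 := (hexp m hm).2 i
      have h2 := hl i hil
      lia
    have hmem : i ∈ Finset.univ.erase l := Finset.mem_erase.2 ⟨hil, Finset.mem_univ i⟩
    have hpos : 0 < weightAt μ (Finset.univ.erase l) m₀ := by
      refine Finset.sum_pos (fun j _ => ?_) ⟨i, hmem⟩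
      have := hμ j
      positivity
    have hge : 1 ≤ weightAt μ (Finset.univ.erase l) m - weightAt μ (Finset.univ.erase l) m₀ := by
      rw [weightAt, weightAt, ← Finset.sum_sub_distrib]
      refine le_trans ?_ (Finset.single_le_sum (fun j hj => ?_) hmem)
      · have : (m₀ i : ℝ) + 2 ≤ m i := by exact_mod_cast hi2
        linarith
      · have h1 := (hexp m hm).le j
        rw [← hl j (Finset.ne_of_mem_erase hj)] at h1
        have : (m₀ j : ℝ) ≤ m j := by exact_mod_cast h1
        linarith
    have hfac : (weightAt μ (Finset.univ.erase l) m - weightAt μ (Finset.univ.erase l) m₀)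
        * (weightAt μ (Finset.univ.erase l) m + weightAt μ (Finset.univ.erase l) m₀ - 1) = 0 := by
      linear_combination hcm
    rcases mul_eq_zero.1 hfac with h | h <;> linarith
  · intro i hi
    split_ifs
    · rw [hM _ (by simp [Finset.ne_of_mem_erase hi]), mul_zero]
    · rfl

/-- Every nonzero stable subspace contains a zonal vector. The coefficient functional at the
highest power of `y_l` vanishes on the range of `C_{[n] ∖ {l}} - c` but not on the subspace, so
this operator is not surjective there, hence not injective by finite dimension. -/
theorem exists_zonal_of_stable (hμ : ∀ i, 0 < μ i)
    {U : Submodule 𝕜 (MvPolynomial (Fin n) 𝕜)}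
    (hU : U ≤ dunklHarmonics (fun i => (μ i : 𝕜)) a ε) (hU0 : U ≠ ⊥)
    (hst : ∀ A : Finset (Fin n), ∀ v ∈ U, dunklRep (fun i => (μ i : 𝕜)) (casimirAt A) v ∈ U)
    (l : Fin n) : ∃ p ∈ U, ∃ m, IsExponent a ε m ∧ (∀ i, i ≠ l → m i = (ε i : ℕ)) ∧
      coeff m p ≠ 0 ∧ dunklRep (fun i => (μ i : 𝕜)) (casimirAt (Finset.univ.erase l)) p
        = (weightAt (fun i => (μ i : 𝕜)) (Finset.univ.erase l) m ^ 2
          - weightAt (fun i => (μ i : 𝕜)) (Finset.univ.erase l) m) • p := by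
  obtain ⟨q, hq, m, hm, hl⟩ := exists_coeff_ne_zero_of_stable hμ hU hU0 hst l
  have hexp : IsExponent a ε m := (mem_dunklHarmonics_iff.1 (hU hq)).2 m hm
  set c : 𝕜 := weightAt (fun i => (μ i : 𝕜)) (Finset.univ.erase l) m ^ 2
    - weightAt (fun i => (μ i : 𝕜)) (Finset.univ.erase l) m
  let T : Module.End 𝕜 (MvPolynomial (Fin n) 𝕜) :=
    dunklRep (fun i => (μ i : 𝕜)) (casimirAt (Finset.univ.erase l)) - c • 1
  have hT : ∀ v ∈ U, T v ∈ U := fun v hv => U.sub_mem (hst _ v hv) (U.smul_mem c hv)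
  have hT0 : ∀ v, coeff m (T v) = 0 := fun v => by
    rw [LinearMap.sub_apply, coeff_sub, LinearMap.smul_apply, coeff_smul, Module.End.one_apply,
      coeff_dunklRep_casimirAt_of_lt (fun i hi => ?_), smul_eq_mul, sub_self]
    rw [hl i (Finset.ne_of_mem_erase hi)]
    exact (ε i).isLt
  have : FiniteDimensional 𝕜 U := Submodule.finiteDimensional_of_le hU
  have hinj : ¬ Function.Injective (T.restrict hT) := by
    rw [LinearMap.injective_iff_surjective]
    intro hs
    obtain ⟨v, hv⟩ := hs ⟨q, hq⟩
    refine hm ?_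
    rw [← hT0 v]
    exact congrArg (coeff m) (congrArg Subtype.val hv).symm
  rw [← LinearMap.ker_eq_bot, ← ne_eq, Submodule.ne_bot_iff] at hinj
  obtain ⟨v, hv, hv0⟩ := hinj
  have hev : dunklRep (fun i => (μ i : 𝕜)) (casimirAt (Finset.univ.erase l)) (v : MvPolynomial _ 𝕜)
      = c • (v : MvPolynomial _ 𝕜) := sub_eq_zero.1 (congrArg Subtype.val (LinearMap.mem_ker.1 hv))
  refine ⟨v, v.2, m, hexp, hl, fun h => hv0 (Subtype.ext ?_), hev⟩
  exact eq_zero_of_zonal hμ hexp hl (hU v.2) hev h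

end Zonal

/-! ### Irreducibility -/

section Irreducible

variable {𝕜 : Type*} [RCLike 𝕜] {n : ℕ} {μ : Fin n → ℝ} {a : ℕ} {ε : Fin n → Fin 2}

/-- A nonzero stable subspace is everything: it and its orthogonal complement would otherwise both
contain zonal vectors, which are proportional to each other. -/
theorem eq_bot_or_eq_of_stable (hμ : ∀ i, 0 < μ i) (l : Fin n)
    {U : Submodule 𝕜 (MvPolynomial (Fin n) 𝕜)}
    (hU : U ≤ dunklHarmonics (fun i => (μ i : 𝕜)) a ε)
    (hst : ∀ A : Finset (Fin n), ∀ v ∈ U, dunklRep (fun i => (μ i : 𝕜)) (casimirAt A) v ∈ U) :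
    U = ⊥ ∨ U = dunklHarmonics (fun i => (μ i : 𝕜)) a ε := by
  by_contra! h
  obtain ⟨V, hV, hV0, hVst, horth⟩ := exists_stable_orthogonal hμ hU h.2 hst
  obtain ⟨u, hu, m, hm, hml, hmu, hCu⟩ := exists_zonal_of_stable hμ hU h.1 hst l
  obtain ⟨v, hv, m', hm', hml', hmv, hCv⟩ := exists_zonal_of_stable hμ hV hV0 hVst l
  obtain rfl : m = m' := hm.ext_off hm' l fun i hi => (hml i hi).trans (hml' i hi).symm
  have h0 : coeff m v • u - coeff m u • v = 0 := by
    refine eq_zero_of_zonal hμ hm hml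
      (Submodule.sub_mem _ (Submodule.smul_mem _ _ (hU hu)) (Submodule.smul_mem _ _ (hV hv))) ?_ ?_
    · rw [map_sub, map_smul, map_smul, hCu, hCv, smul_sub, smul_comm (coeff m v),
        smul_comm (coeff m u)]
    · rw [coeff_sub, coeff_smul, coeff_smul, smul_eq_mul, smul_eq_mul]
      ring
  have hvU : v ∈ U := by
    rw [sub_eq_zero] at h0
    rw [← inv_smul_smul₀ hmu v, ← h0]
    exact U.smul_mem _ (U.smul_mem _ hu)
  refine hmv ?_
  rw [eq_zero_of_dunklForm_self hμ (horth v hv v hvU), coeff_zero]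

end Irreducible

end RacahDunkl

theorem lemma4p2 {𝕜 : Type*} [RCLike 𝕜] (n : ℕ) (hn : 2 ≤ n) (μ : Fin n → ℝ) (hμ : ∀ i, 0 < μ i)
    (a : ℕ) (ε : Fin n → Fin 2) :
    ((∃ N : ℕ, a = (∑ i, (ε i : ℕ)) + 2 * N) →
      RacahDunkl.IsIrreducibleOn (RacahDunkl.dunklRep fun i => (μ i : 𝕜))
        (RacahDunkl.racahAlgebra 𝕜 n) (RacahDunkl.dunklHarmonics (fun i => (μ i : 𝕜)) a ε)) ∧
    ((¬ ∃ N : ℕ, a = (∑ i, (ε i : ℕ)) + 2 * N) →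
      RacahDunkl.dunklHarmonics (fun i => (μ i : 𝕜)) a ε = ⊥) := by
  refine ⟨fun ⟨N, hN⟩ => ⟨?_, ?_, fun U hU hst => ?_⟩, RacahDunkl.dunklHarmonics_eq_bot⟩
  · exact RacahDunkl.racahAlgebra_stable _ fun A v hv =>
      RacahDunkl.casimirAt_mem_dunklHarmonics A hv
  · have hne : (⟨0, by lia⟩ : Fin n) ≠ ⟨1, by lia⟩ := by simp
    exact RacahDunkl.dunklHarmonics_ne_bot hμ hne N hN
  · exact RacahDunkl.eq_bot_or_eq_of_stable hμ ⟨0, by lia⟩ hU fun A =>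
      hst _ (RacahDunkl.casimirAt_mem_racahAlgebra A)
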